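/- Work over $\mathbb{C}$. For elements $u_1,\dots,u_4$, $v_0,\dots,v_3$, $d_0,\dots,d_3$ of a commutative ring put $$U=\begin{pmatrix}u_1&u_2\\u_3&u_4\end{pmatrix},\quad V=\begin{pmatrix}v_2&v_1&v_0\\-v_3&-v_2&-v_1\end{pmatrix},\quad D=\begin{pmatrix}d_2&d_1&d_0\\-d_3&-d_2&-d_1\end{pmatrix},$$ $$\widehat U=\begin{pmatrix}u_1^2&u_1u_2&u_2^2\\2u_1u_3&u_1u_4+u_2u_3&2u_2u_4\\u_3^2&u_3u_4&u_4^2\end{pmatrix},\quad \widehat U^{\dagger}=\begin{pmatrix}u_4^2&-u_2u_4&u_2^2\\-2u_3u_4&u_1u_4+u_2u_3&-2u_1u_2\\u_3^2&-u_1u_3&u_1^2\end{pmatrix},$$ define $\widehat g$ for any $2\times2$ matrix $g$ in the same way as $\widehat U$ for $U$, and for a $2\times 3$ matrix $M$ with rows $(f_1,f_2,f_3)$, $(g_1,g_2,g_3)$ let $\wedge^2M=(f_2g_3-f_3g_2,\,-(f_1g_3-f_3g_1),\,f_1g_2-f_2g_1)$. Let $\mathbb{A}^4_D$ be the affine space with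 coordinates $d_0,\dots,d_3$ and let $\mathbb{P}^7$ have homogeneous coordinates $u_1,\dots,u_4,v_0,\dots,v_3$. Let $\widehat{\mathfrak S}^7\subset\mathbb{A}^4_D\times\mathbb{P}^7$ be the closed subscheme defined by the nine equations $$UV=D\widehat U,\qquad \wedge^2V=(\wedge^2D)\,{}^t\widehat U^{\dagger},$$ which are quadratic in the coordinates of $\mathbb{P}^7$, and let $\rho_{\mathfrak S}\colon\widehat{\mathfrak S}^7\to\mathbb{A}^4_D$ be the projection. Let $\mathrm{SL}_2\times(\mathbb{C}^*)^2$ act on $\mathbb{A}^4_D$ by $(g,\alpha,\beta)\cdot D=\beta\, gD\widehat g^{-1}$. Let $C=\{\wedge^2D=0\}\subset\mathbb{A}^4_D$ be the cone over the twisted cubic and let $$T=\{3d_1^2d_2^2-4d_1^3d_3-4d_0d_2^3+6d_0d_1d_2d_3-d_0^2d_3^2=0\}$$ be the cone over its tangential scroll. Let $\mathsf Q=\{q_3^2=q_1q_2\}\subset\mathbb{P}^3$ be the cone over a smooth conic, and let $\mathbb{P}^{1,1,1}\subset\mathbb{P}^7$ denote the projective threefold defined by $$\operatorname{rk}\begin{pmatrix}u_3&v_3&v_2&v_1\\u_4&v_2&v_1&v_0\end{pmatrix}\le1,\quad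 u_1v_2-u_2v_3=u_3^2,\quad u_1v_1-u_2v_2=u_3u_4,\quad u_1v_0-u_2v_1=u_4^2 .$$ **Proposition.** Let $\mathsf p$ be a (closed) point of $\mathbb{A}^4_D$ and let $F_{\mathsf p}$ be the scheme-theoretic fiber of $\rho_{\mathfrak S}$ over $\mathsf p$. Each of the four sets $\{0\}$, $C\setminus\{0\}$, $T\setminus C$, $\mathbb{A}^4_D\setminus T$ is a single orbit of $\mathrm{SL}_2\times(\mathbb{C}^*)^2$ (that is, if $\mathsf p$ lies in the set, then the orbit of $\mathsf p$ is the whole set), and: 1. if $\mathsf p=0$, then $F_{\mathsf p}$ is the closed subscheme $\{UV=0,\ \wedge^2V=0\}$ of $\mathbb{P}^7$ (isomorphic to it over $\mathbb{P}^7$); 2. if $\mathsf p\in C\setminus\{0\}$, then $F_{\mathsf p}\simeq\mathbb{P}^{1,1,1}$; 3. if $\mathsf p\in T\setminus C$, then $F_{\mathsf p}\simeq\mathbb{P}^1\times\mathsf Q$; 4. if $\mathsf p\in\mathbb{A}^4_D\setminus T$, then $F_{\mathsf p}\simeq\mathbb{P}^1\times\mathbb{P}^1\times\mathbb{P}^1$.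 In 2--4 the isomorphisms are isomorphisms of schemes over $\mathbb{C}$. -/

import Mathlib

open CategoryTheory AlgebraicGeometry MvPolynomial

noncomputable section

namespace SFib

attribute [local instance] MvPolynomial.gradedAlgebra

/-! ### Closed subschemes of projective space cut out by homogeneous polynomials -/

section Proj

variable {R σ : Type} [CommRing R]

/-- The standard (total degree) grading on `R[x_i : i ∈ σ]`. -/
abbrev stdGrading (R σ : Type) [CommRing R] : ℕ → Submodule R (MvPolynomial σ R) :=
  homogeneousSubmodule σ R

/-- The grading induced by the total degree on `R[x_i : i ∈ σ] / I`. -/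
def quotGrading (I : HomogeneousIdeal (stdGrading R σ)) :
    ℕ → Submodule R (MvPolynomial σ R ⧸ I.toIdeal) :=
  fun n => (stdGrading R σ n).map (Ideal.Quotient.mkₐ R I.toIdeal).toLinearMap

theorem mk_mem_quotGrading (I : HomogeneousIdeal (stdGrading R σ)) {n : ℕ}
    {f : MvPolynomial σ R} (hf : f ∈ stdGrading R σ n) :
    Ideal.Quotient.mk I.toIdeal f ∈ quotGrading I n :=
  ⟨f, hf, rfl⟩

instance quotGrading_gradedMonoid (I : HomogeneousIdeal (stdGrading R σ)) :
    SetLike.GradedMonoid (quotGrading I) where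
  one_mem := ⟨1, SetLike.GradedOne.one_mem, map_one (Ideal.Quotient.mkₐ R I.toIdeal)⟩
  mul_mem := by
    rintro i j _ _ ⟨a, ha, rfl⟩ ⟨b, hb, rfl⟩
    exact ⟨a * b, SetLike.GradedMul.mul_mem ha hb, map_mul (Ideal.Quotient.mkₐ R I.toIdeal) a b⟩

theorem quotGrading_isInternal (I : HomogeneousIdeal (stdGrading R σ)) :
    DirectSum.IsInternal (quotGrading I) := by
  classical
  constructor
  · rw [injective_iff_map_eq_zero]
    intro x hx
    choose a ha hax using fun i => (x i).2
    have hsum : (∑ i ∈ x.support, a i) ∈ I.toIdeal := by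
      rw [← Ideal.Quotient.eq_zero_iff_mem, map_sum, ← hx, DirectSum.coeAddMonoidHom_eq_dfinsuppSum]
      exact Finset.sum_congr rfl fun i _ => hax i
    ext i
    by_cases hi : i ∈ x.support
    · have h := I.isHomogeneous i hsum
      have h2 : ((DirectSum.decompose (stdGrading R σ) (∑ j ∈ x.support, a j)) i :
          MvPolynomial σ R) = a i := by
        rw [DirectSum.decompose_sum, DFinsupp.finsetSum_apply, AddSubmonoidClass.coe_finsetSum,
          Finset.sum_eq_single i]
        · exact DirectSum.decompose_of_mem_same _ (ha i)
        · intro j _ hj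
          exact DirectSum.decompose_of_mem_ne _ (ha j) hj
        · intro h'
          exact absurd hi h'
      rw [h2] at h
      have h3 := hax i
      rw [← h3]
      simpa using Ideal.Quotient.eq_zero_iff_mem.2 h
    · simpa using hi
  · intro y
    obtain ⟨f, rfl⟩ := Ideal.Quotient.mk_surjective y
    refine ⟨∑ i ∈ (DirectSum.decompose (stdGrading R σ) f).support,
      DirectSum.of (fun i => quotGrading I i) i
        ⟨Ideal.Quotient.mk I.toIdeal (DirectSum.decompose (stdGrading R σ) f i),
          mk_mem_quotGrading I (DirectSum.decompose (stdGrading R σ) f i).2⟩, ?_⟩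
    rw [map_sum]
    simp only [DirectSum.coeAddMonoidHom_of]
    rw [← map_sum, DirectSum.sum_support_decompose]

instance quotGrading_gradedAlgebra (I : HomogeneousIdeal (stdGrading R σ)) :
    GradedAlgebra (quotGrading I) where
  toDecomposition := (quotGrading_isInternal I).chooseDecomposition

/-- The closed subscheme `V₊(I) = Proj (R[x_i : i ∈ σ] / I)` of projective space over `Spec R`. -/
def projZeros (I : HomogeneousIdeal (stdGrading R σ)) : Scheme :=
  Proj (quotGrading I)

/-- The structure morphism `V₊(I) ⟶ Spec R`. -/
def projZerosToSpec (I : HomogeneousIdeal (stdGrading R σ)) :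
    projZeros I ⟶ Spec (.of R) :=
  Proj.toSpecZero (quotGrading I) ≫
    Spec.map (CommRingCat.ofHom (algebraMap R (quotGrading I 0)))

/-- The projective space with homogeneous coordinates indexed by `σ` over `Spec R`. -/
def projSpace (R σ : Type) [CommRing R] : Scheme :=
  Proj (stdGrading R σ)

/-- The structure morphism of projective space. -/
def projSpaceToSpec (R σ : Type) [CommRing R] : projSpace R σ ⟶ Spec (.of R) :=
  Proj.toSpecZero (stdGrading R σ) ≫
    Spec.map (CommRingCat.ofHom (algebraMap R (stdGrading R σ 0)))

/-- For a `k`-algebra `R`, the graded ring homomorphism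
`k[x_i : i ∈ σ] → R[x_i : i ∈ σ] / I`, `x_i ↦ x_i`. -/
def coordHom (k : Type) [CommRing k] [Algebra k R] (I : HomogeneousIdeal (stdGrading R σ)) :
    GradedRingHom (stdGrading k σ) (quotGrading I) where
  toRingHom := (Ideal.Quotient.mk I.toIdeal).comp (MvPolynomial.map (algebraMap k R))
  map_mem {_ _} hf :=
    mk_mem_quotGrading I
      ((mem_homogeneousSubmodule _ _).2 (((mem_homogeneousSubmodule _ _).1 hf).map _))

theorem irrelevant_le_map_coordHom (k : Type) [CommRing k] [Algebra k R]
    (I : HomogeneousIdeal (stdGrading R σ)) :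
    HomogeneousIdeal.irrelevant (quotGrading I) ≤
      (HomogeneousIdeal.irrelevant (stdGrading k σ)).map (coordHom k I) := by
  rw [HomogeneousIdeal.irrelevant_le]
  rintro n hn _ ⟨f, hf, rfl⟩
  have hX : f ∈ Ideal.span (X '' (Set.univ : Set σ)) := by
    rw [mem_ideal_span_X_image]
    intro m hm
    by_contra! h
    have h0 : m = 0 := by
      ext i
      exact h i (Set.mem_univ i)
    have h1 := ((mem_homogeneousSubmodule _ _).1 hf) (mem_support_iff.1 hm)
    rw [h0] at h1
    simp at h1
    omega
  have hle : Ideal.span (X '' (Set.univ : Set σ)) ≤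
      Ideal.comap (Ideal.Quotient.mk I.toIdeal)
        (((HomogeneousIdeal.irrelevant (stdGrading k σ)).map (coordHom k I)).toIdeal) := by
    rw [Ideal.span_le]
    rintro _ ⟨i, -, rfl⟩
    have hi : (X i : MvPolynomial σ k) ∈ HomogeneousIdeal.irrelevant (stdGrading k σ) :=
      HomogeneousIdeal.mem_irrelevant_of_mem _ one_pos (isHomogeneous_X k i)
    have h2 := Ideal.mem_map_of_mem (coordHom k I) hi
    have h3 : coordHom k I (X i) = Ideal.Quotient.mk I.toIdeal (X i) := by
      change Ideal.Quotient.mk I.toIdeal (MvPolynomial.map (algebraMap k R) (X i)) = _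
      rw [map_X]
    rw [h3] at h2
    exact h2
  exact hle hX

/-- The morphism `V₊(I) ⟶ ℙ_k` given by the homogeneous coordinates `x_i`. For `R = k` it is the
closed immersion of `V₊(I)` into projective space, and in general it is the closed immersion of
`V₊(I)` into `Spec R × ℙ_k` followed by the second projection. -/
def projZerosToProj (k : Type) [CommRing k] [Algebra k R]
    (I : HomogeneousIdeal (stdGrading R σ)) : projZeros I ⟶ projSpace k σ :=
  Proj.map (coordHom k I) (irrelevant_le_map_coordHom k I)

/-- The homogeneous ideal generated by a family of forms of degree two. -/
def quadricIdeal {ι : Type} (f : ι → MvPolynomial σ R) (hf : ∀ i, (f i).IsHomogeneous 2) :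
    HomogeneousIdeal (stdGrading R σ) :=
  ⟨Ideal.span (Set.range f), Ideal.homogeneous_span _ _ (by
    rintro _ ⟨i, rfl⟩
    exact ⟨2, hf i⟩)⟩

end Proj

/-! ### The matrices -/

section Matrices

variable {A : Type} [CommRing A]

/-- The matrix `U` with entries `u₁, u₂, u₃, u₄`; here `u i` stands for `u_{i+1}`. -/
def matU (u : Fin 4 → A) : Matrix (Fin 2) (Fin 2) A :=
  !![u 0, u 1; u 2, u 3]

/-- The common shape of the matrices `V` (with entries `v₀, …, v₃`) and `D` (with entries
`d₀, …, d₃`). -/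
def matV (v : Fin 4 → A) : Matrix (Fin 2) (Fin 3) A :=
  !![v 2, v 1, v 0; -v 3, -v 2, -v 1]

/-- The matrix `M̂` attached to a `2 × 2` matrix `M`. -/
def hat (M : Matrix (Fin 2) (Fin 2) A) : Matrix (Fin 3) (Fin 3) A :=
  !![M 0 0 ^ 2, M 0 0 * M 0 1, M 0 1 ^ 2;
     2 * (M 0 0 * M 1 0), M 0 0 * M 1 1 + M 0 1 * M 1 0, 2 * (M 0 1 * M 1 1);
     M 1 0 ^ 2, M 1 0 * M 1 1, M 1 1 ^ 2]

/-- The matrix `M̂†` attached to a `2 × 2` matrix `M`. -/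
def hatDagger (M : Matrix (Fin 2) (Fin 2) A) : Matrix (Fin 3) (Fin 3) A :=
  !![M 1 1 ^ 2, -(M 0 1 * M 1 1), M 0 1 ^ 2;
     -(2 * (M 1 0 * M 1 1)), M 0 0 * M 1 1 + M 0 1 * M 1 0, -(2 * (M 0 0 * M 0 1));
     M 1 0 ^ 2, -(M 0 0 * M 1 0), M 0 0 ^ 2]

/-- The row vector `∧²M` of signed `2 × 2` minors of a `2 × 3` matrix `M`. -/
def wedge2 (M : Matrix (Fin 2) (Fin 3) A) : Fin 3 → A :=
  ![M 0 1 * M 1 2 - M 0 2 * M 1 1,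
    -(M 0 0 * M 1 2 - M 0 2 * M 1 0),
    M 0 0 * M 1 1 - M 0 1 * M 1 0]

/-- The nine equations `U V = D Û` and `∧²V = (∧²D) ᵗÛ†`, written as "left side minus right
side". -/
def eqS (d u v : Fin 4 → A) : (Fin 2 × Fin 3) ⊕ Fin 3 → A :=
  Sum.elim
    (fun ij => (matU u * matV v - matV d * hat (matU u)) ij.1 ij.2)
    (fun j => (wedge2 (matV v) -
      Matrix.vecMul (wedge2 (matV d)) (hatDagger (matU u)).transpose) j)

/-- The nine equations `U V = 0` and `∧²V = 0`. -/
def eqS0 (u v : Fin 4 → A) : (Fin 2 × Fin 3) ⊕ Fin 3 → A :=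
  Sum.elim (fun ij => (matU u * matV v) ij.1 ij.2) (fun j => wedge2 (matV v) j)

/-- The matrix with rows `(u₃, v₃, v₂, v₁)` and `(u₄, v₂, v₁, v₀)`. -/
def matN (u v : Fin 4 → A) : Matrix (Fin 2) (Fin 4) A :=
  !![u 2, v 3, v 2, v 1; u 3, v 2, v 1, v 0]

/-- The `2 × 2` minors of the matrix with rows `(u₃, v₃, v₂, v₁)` and `(u₄, v₂, v₁, v₀)`, and
the three forms `u₁v₂ - u₂v₃ - u₃²`, `u₁v₁ - u₂v₂ - u₃u₄`, `u₁v₀ - u₂v₁ - u₄²`. -/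
def eqP111 (u v : Fin 4 → A) : (Fin 4 × Fin 4) ⊕ Fin 3 → A :=
  Sum.elim
    (fun jk => ((matN u v).submatrix id ![jk.1, jk.2]).det)
    ![u 0 * v 2 - u 1 * v 3 - u 2 ^ 2,
      u 0 * v 1 - u 1 * v 2 - u 2 * u 3,
      u 0 * v 0 - u 1 * v 1 - u 3 ^ 2]

end Matrices

/-! ### Coordinates -/

section Coordinates

variable (R : Type) [CommRing R]

/-- The index set of the homogeneous coordinates `u₁, …, u₄, v₀, …, v₃` of `ℙ⁷`. -/
abbrev FIdx : Type := Fin 4 ⊕ Fin 4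

/-- The coordinates `u₁, …, u₄`. -/
def uVar (i : Fin 4) : MvPolynomial FIdx R := X (Sum.inl i)

/-- The coordinates `v₀, …, v₃`. -/
def vVar (i : Fin 4) : MvPolynomial FIdx R := X (Sum.inr i)

/-- The coordinate ring `ℂ[d₀, d₁, d₂, d₃]` of the affine space `𝔸⁴_D`. -/
abbrev RD : Type := MvPolynomial (Fin 4) ℂ

/-- The coordinates `d₀, …, d₃`, as elements of degree zero. -/
def dVar (i : Fin 4) : MvPolynomial FIdx RD := C (X i)

theorem uVar_isHomogeneous (i : Fin 4) : (uVar R i).IsHomogeneous 1 := isHomogeneous_X _ _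

theorem vVar_isHomogeneous (i : Fin 4) : (vVar R i).IsHomogeneous 1 := isHomogeneous_X _ _

theorem dVar_isHomogeneous (i : Fin 4) : (dVar i).IsHomogeneous 0 := isHomogeneous_C _ _

end Coordinates

section Homogeneity

variable {R σ : Type} [CommRing R]

theorem isHomogeneous_two_mul {a : MvPolynomial σ R} {n : ℕ} (ha : a.IsHomogeneous n) :
    (2 * a).IsHomogeneous n := by
  rw [two_mul]
  exact ha.add ha

theorem isHomogeneous_mul_of_eq {a b : MvPolynomial σ R} {m n k : ℕ} (ha : a.IsHomogeneous m)
    (hb : b.IsHomogeneous n) (h : m + n = k) : (a * b).IsHomogeneous k :=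
  h ▸ ha.mul hb

theorem matU_isHomogeneous {u : Fin 4 → MvPolynomial σ R} (hu : ∀ i, (u i).IsHomogeneous 1)
    (i j : Fin 2) : (matU u i j).IsHomogeneous 1 := by
  fin_cases i <;> fin_cases j <;> exact hu _

theorem matV_isHomogeneous {v : Fin 4 → MvPolynomial σ R} {n : ℕ}
    (hv : ∀ i, (v i).IsHomogeneous n) (i : Fin 2) (j : Fin 3) :
    (matV v i j).IsHomogeneous n := by
  fin_cases i <;> fin_cases j <;> first | exact hv _ | exact (hv _).neg

theorem hat_isHomogeneous {M : Matrix (Fin 2) (Fin 2) (MvPolynomial σ R)}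
    (hM : ∀ i j, (M i j).IsHomogeneous 1) (i j : Fin 3) : (hat M i j).IsHomogeneous 2 := by
  have h (a b c d) : (M a b * M c d).IsHomogeneous 2 := (hM a b).mul (hM c d)
  have h2 (a b) : (M a b ^ 2).IsHomogeneous 2 := (hM a b).pow 2
  fin_cases i <;> fin_cases j
  · exact h2 _ _
  · exact h _ _ _ _
  · exact h2 _ _
  · exact isHomogeneous_two_mul (h _ _ _ _)
  · exact (h _ _ _ _).add (h _ _ _ _)
  · exact isHomogeneous_two_mul (h _ _ _ _)
  · exact h2 _ _
  · exact h _ _ _ _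
  · exact h2 _ _

theorem hatDagger_isHomogeneous {M : Matrix (Fin 2) (Fin 2) (MvPolynomial σ R)}
    (hM : ∀ i j, (M i j).IsHomogeneous 1) (i j : Fin 3) :
    (hatDagger M i j).IsHomogeneous 2 := by
  have h (a b c d) : (M a b * M c d).IsHomogeneous 2 := (hM a b).mul (hM c d)
  have h2 (a b) : (M a b ^ 2).IsHomogeneous 2 := (hM a b).pow 2
  fin_cases i <;> fin_cases j
  · exact h2 _ _
  · exact (h _ _ _ _).neg
  · exact h2 _ _
  · exact (isHomogeneous_two_mul (h _ _ _ _)).neg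
  · exact (h _ _ _ _).add (h _ _ _ _)
  · exact (isHomogeneous_two_mul (h _ _ _ _)).neg
  · exact h2 _ _
  · exact (h _ _ _ _).neg
  · exact h2 _ _

theorem wedge2_isHomogeneous {M : Matrix (Fin 2) (Fin 3) (MvPolynomial σ R)} {n k : ℕ}
    (hM : ∀ i j, (M i j).IsHomogeneous n) (hk : n + n = k) (j : Fin 3) :
    (wedge2 M j).IsHomogeneous k := by
  have h (a b c d) : (M a b * M c d).IsHomogeneous k :=
    isHomogeneous_mul_of_eq (hM a b) (hM c d) hk
  fin_cases j
  · exact (h _ _ _ _).sub (h _ _ _ _)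
  · exact ((h _ _ _ _).sub (h _ _ _ _)).neg
  · exact (h _ _ _ _).sub (h _ _ _ _)

theorem eqS_isHomogeneous {d u v : Fin 4 → MvPolynomial σ R} (hd : ∀ i, (d i).IsHomogeneous 0)
    (hu : ∀ i, (u i).IsHomogeneous 1) (hv : ∀ i, (v i).IsHomogeneous 1)
    (i : (Fin 2 × Fin 3) ⊕ Fin 3) : (eqS d u v i).IsHomogeneous 2 := by
  have hU := matU_isHomogeneous hu
  rcases i with ⟨i, j⟩ | j
  · refine IsHomogeneous.sub (IsHomogeneous.sum _ _ _ fun k _ => ?_)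
      (IsHomogeneous.sum _ _ _ fun k _ => ?_)
    · exact isHomogeneous_mul_of_eq (hU i k) (matV_isHomogeneous hv k j) rfl
    · exact isHomogeneous_mul_of_eq (matV_isHomogeneous hd i k) (hat_isHomogeneous hU k j) rfl
  · refine IsHomogeneous.sub (wedge2_isHomogeneous (matV_isHomogeneous hv) rfl j)
      (IsHomogeneous.sum _ _ _ fun k _ => ?_)
    exact isHomogeneous_mul_of_eq (wedge2_isHomogeneous (matV_isHomogeneous hd) rfl k)
      (hatDagger_isHomogeneous hU j k) rfl

theorem eqS0_isHomogeneous {u v : Fin 4 → MvPolynomial σ R}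
    (hu : ∀ i, (u i).IsHomogeneous 1) (hv : ∀ i, (v i).IsHomogeneous 1)
    (i : (Fin 2 × Fin 3) ⊕ Fin 3) : (eqS0 u v i).IsHomogeneous 2 := by
  have hU := matU_isHomogeneous hu
  rcases i with ⟨i, j⟩ | j
  · change (∑ k, matU u i k * matV v k j).IsHomogeneous 2
    refine IsHomogeneous.sum _ _ _ fun k _ => ?_
    exact isHomogeneous_mul_of_eq (hU i k) (matV_isHomogeneous hv k j) rfl
  · exact wedge2_isHomogeneous (matV_isHomogeneous hv) rfl j

theorem eqP111_isHomogeneous {u v : Fin 4 → MvPolynomial σ R}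
    (hu : ∀ i, (u i).IsHomogeneous 1) (hv : ∀ i, (v i).IsHomogeneous 1)
    (i : (Fin 4 × Fin 4) ⊕ Fin 3) : (eqP111 u v i).IsHomogeneous 2 := by
  rcases i with ⟨j, k⟩ | j
  · have h : ∀ (i : Fin 2) (j : Fin 4), ((matN u v) i j).IsHomogeneous 1 := by
      intro i j
      fin_cases i <;> fin_cases j
      · exact hu 2
      · exact hv 3
      · exact hv 2
      · exact hv 1
      · exact hu 3
      · exact hv 2
      · exact hv 1
      · exact hv 0
    change (((matN u v).submatrix id ![j, k]).det).IsHomogeneous 2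
    have h' : ∀ a b : Fin 2, (((matN u v).submatrix id ![j, k]) a b).IsHomogeneous 1 :=
      fun a b => h a (![j, k] b)
    generalize (matN u v).submatrix id ![j, k] = M at h' ⊢
    rw [Matrix.det_fin_two]
    exact ((h' 0 0).mul (h' 1 1)).sub ((h' 0 1).mul (h' 1 0))
  · have h1 (a b) : (u a * v b).IsHomogeneous 2 := (hu a).mul (hv b)
    have h2 (a b) : (u a * u b).IsHomogeneous 2 := (hu a).mul (hu b)
    have h3 (a) : (u a ^ 2).IsHomogeneous 2 := (hu a).pow 2
    fin_cases j
    · change (u 0 * v 2 - u 1 * v 3 - u 2 ^ 2).IsHomogeneous 2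
      exact ((h1 0 2).sub (h1 1 3)).sub (h3 2)
    · change (u 0 * v 1 - u 1 * v 2 - u 2 * u 3).IsHomogeneous 2
      exact ((h1 0 1).sub (h1 1 2)).sub (h2 2 3)
    · change (u 0 * v 0 - u 1 * v 1 - u 3 ^ 2).IsHomogeneous 2
      exact ((h1 0 0).sub (h1 1 1)).sub (h3 3)

end Homogeneity

/-! ### The varieties -/

section Varieties

/-- The point `Spec ℂ`. -/
abbrev SpecC : Scheme := Spec (.of ℂ)

/-- The affine space `𝔸⁴_D = Spec ℂ[d₀, d₁, d₂, d₃]`. -/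
abbrev AD : Scheme := Spec (.of RD)

/-- The homogeneous ideal of `ℂ[d₀, …, d₃][u₁, …, u₄, v₀, …, v₃]` generated by the nine equations
`U V = D Û`, `∧²V = (∧²D) ᵗÛ†`, where the entries of `D` have degree zero. -/
def idealS : HomogeneousIdeal (stdGrading RD FIdx) :=
  quadricIdeal (eqS dVar (uVar RD) (vVar RD))
    (eqS_isHomogeneous dVar_isHomogeneous (uVar_isHomogeneous _) (vVar_isHomogeneous _))

/-- The variety `𝔖̂⁷ ⊆ 𝔸⁴_D × ℙ⁷`. -/
def SHat : Scheme := projZeros idealS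

/-- The natural projection `ρ : 𝔖̂⁷ ⟶ 𝔸⁴_D`. -/
def rho : SHat ⟶ AD := projZerosToSpec idealS

/-- The projection `𝔖̂⁷ ⟶ ℙ⁷`. -/
def SHatToProj : SHat ⟶ projSpace ℂ FIdx := projZerosToProj ℂ idealS

/-- The closed point of `𝔸⁴_D` with coordinates `(d₀, d₁, d₂, d₃) = p`. -/
def pointD (p : Fin 4 → ℂ) : SpecC ⟶ AD :=
  Spec.map (CommRingCat.ofHom (MvPolynomial.eval p))

/-- The scheme-theoretic fiber `F_p` of `ρ` over the point `p`, as a scheme over `ℂ`. -/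
def fiber (p : Fin 4 → ℂ) : Over SpecC :=
  Over.mk (Limits.pullback.snd rho (pointD p))

/-- The fiber `F_p`, as a scheme over `ℙ⁷` via `F_p ⟶ 𝔖̂⁷ ⟶ ℙ⁷`. -/
def fiberInProj (p : Fin 4 → ℂ) : Over (projSpace ℂ FIdx) :=
  Over.mk (Limits.pullback.fst rho (pointD p) ≫ SHatToProj)

/-- The homogeneous ideal of `ℂ[u₁, …, u₄, v₀, …, v₃]` generated by the equations
`U V = 0`, `∧²V = 0`. -/
def idealS0 : HomogeneousIdeal (stdGrading ℂ FIdx) :=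
  quadricIdeal (eqS0 (uVar ℂ) (vVar ℂ))
    (eqS0_isHomogeneous (uVar_isHomogeneous _) (vVar_isHomogeneous _))

/-- The closed subscheme `{U V = 0, ∧²V = 0}` of `ℙ⁷`, as a scheme over `ℙ⁷`. -/
def zeroFiberInProj : Over (projSpace ℂ FIdx) :=
  Over.mk (projZerosToProj ℂ idealS0)

/-- The homogeneous ideal defining `ℙ^{1,1,1}` in `ℙ⁷`. -/
def idealP111 : HomogeneousIdeal (stdGrading ℂ FIdx) :=
  quadricIdeal (eqP111 (uVar ℂ) (vVar ℂ))
    (eqP111_isHomogeneous (uVar_isHomogeneous _) (vVar_isHomogeneous _))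

/-- The projective threefold `ℙ^{1,1,1}`. -/
def P111 : Over SpecC := Over.mk (projZerosToSpec idealP111)

/-- The projective line. -/
def P1 : Over SpecC := Over.mk (projSpaceToSpec ℂ (Fin 2))

/-- The homogeneous ideal of the cone over a smooth conic in `ℙ³`. -/
def idealQ : HomogeneousIdeal (stdGrading ℂ (Fin 4)) :=
  quadricIdeal (fun _ : Unit => X 3 ^ 2 - X 1 * X 2) fun _ =>
    ((isHomogeneous_X ℂ (3 : Fin 4)).pow 2).sub ((isHomogeneous_X ℂ 1).mul (isHomogeneous_X ℂ 2))

/-- The cone `Q = {q₃² = q₁ q₂} ⊆ ℙ³` over a smooth conic. -/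
def Q : Over SpecC := Over.mk (projZerosToSpec idealQ)

/-- The product of two schemes over `ℂ`. -/
def prodC (X Y : Over SpecC) : Over SpecC :=
  Over.mk (Limits.pullback.fst X.hom Y.hom ≫ X.hom)

end Varieties

/-! ### The orbits in `𝔸⁴_D` -/

section Orbits

/-- The orbit of `p` under the action of `SL₂ × (ℂ*)²` on `𝔸⁴_D` given by
`D ↦ β g D ĝ⁻¹` for `g ∈ SL₂` and `(α, β) ∈ (ℂ*)²`. -/
def orbitD (p : Fin 4 → ℂ) : Set (Fin 4 → ℂ) :=
  {q | ∃ (g : Matrix.SpecialLinearGroup (Fin 2) ℂ) (t : ℂˣ × ℂˣ),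
    matV q = (t.2 : ℂ) • ((g : Matrix (Fin 2) (Fin 2) ℂ) * matV p *
      (hat (g : Matrix (Fin 2) (Fin 2) ℂ))⁻¹)}

/-- The cone over the twisted cubic, `∧²D = 0`. -/
def twistedCubicCone : Set (Fin 4 → ℂ) :=
  {p | wedge2 (matV p) = 0}

/-- The cone over the tangential scroll of the twisted cubic. -/
def tangentialCone : Set (Fin 4 → ℂ) :=
  {p | 3 * p 1 ^ 2 * p 2 ^ 2 - 4 * p 1 ^ 3 * p 3 - 4 * p 0 * p 2 ^ 3
    + 6 * p 0 * p 1 * p 2 * p 3 - p 0 ^ 2 * p 3 ^ 2 = 0}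

end Orbits

end SFib

end

noncomputable section

namespace SFib

attribute [local instance] MvPolynomial.gradedAlgebra

/-! ### Degree one localizations as dehomogenizations -/

section Dehom

open HomogeneousLocalization

variable {k A : Type} [CommRing k] [CommRing A] [Algebra k A] (𝒜 : ℕ → Submodule k A)
  [GradedAlgebra 𝒜]

/-- The ring homomorphism `A →+* A_(z)`, `a ↦ a / z ^ n` for `a` of degree `n`, attached to an
element `z` of degree one. -/
def dehom {z : A} (hz : z ∈ 𝒜 1) : A →+* Away 𝒜 z :=
  (DirectSum.toSemiring (A := fun i => 𝒜 i)
    (fun n =>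
      { toFun := fun a => Away.mk 𝒜 hz n a (by simp)
        map_zero' := by
          ext
          simp [Localization.mk_zero]
        map_add' := fun a b => by
          ext
          simp [Localization.add_mk_self] })
    (by
      ext
      simp only [AddMonoidHom.coe_mk, ZeroHom.coe_mk, Away.val_mk, val_one]
      rw [← Localization.mk_one]
      congr 1
      ext
      simp)
    (by
      intro i j a b
      ext
      simp only [AddMonoidHom.coe_mk, ZeroHom.coe_mk, Away.val_mk, val_mul, Localization.mk_mul]
      congr 1
      ext
      simp [pow_add])).comp (DirectSum.decomposeRingEquiv 𝒜).toRingHom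

theorem dehom_of_mem {z : A} (hz : z ∈ 𝒜 1) {n : ℕ} {a : A} (ha : a ∈ 𝒜 n) :
    dehom 𝒜 hz a = Away.mk 𝒜 hz n a (by simpa using ha) := by
  rw [dehom, RingHom.comp_apply]
  change DirectSum.toSemiring _ _ _ (DirectSum.decompose 𝒜 a) = _
  rw [DirectSum.decompose_of_mem 𝒜 ha, DirectSum.toSemiring_of]
  rfl

theorem dehom_val {z : A} (hz : z ∈ 𝒜 1) {n : ℕ} {a : A} (ha : a ∈ 𝒜 n) :
    (dehom 𝒜 hz a).val = Localization.mk a (⟨z ^ n, n, rfl⟩ : Submonoid.powers z) := by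
  rw [dehom_of_mem 𝒜 hz ha, Away.val_mk]

theorem dehom_self {z : A} (hz : z ∈ 𝒜 1) : dehom 𝒜 hz z = 1 := by
  ext
  rw [dehom_val 𝒜 hz hz, val_one, ← Localization.mk_one, Localization.mk_eq_mk_iff,
    Localization.r_iff_exists]
  exact ⟨1, by simp⟩

theorem dehom_surjective {z : A} (hz : z ∈ 𝒜 1) : Function.Surjective (dehom 𝒜 hz) := by
  intro a
  obtain ⟨n, a, ha, rfl⟩ := Away.mk_surjective 𝒜 hz a
  exact ⟨a, dehom_of_mem 𝒜 hz (by simpa using ha)⟩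

/-- Ring homomorphisms out of `A_(z)` are determined on scalars and on generators of `A`. -/
theorem away_hom_ext {ι T : Type} [CommRing T] {x : ι → A}
    (hx : Algebra.adjoin k (Set.range x) = ⊤) {z : A} (hz : z ∈ 𝒜 1) {f g : Away 𝒜 z →+* T}
    (h₀ : ∀ c, f (dehom 𝒜 hz (algebraMap k A c)) = g (dehom 𝒜 hz (algebraMap k A c)))
    (h₁ : ∀ i, f (dehom 𝒜 hz (x i)) = g (dehom 𝒜 hz (x i))) : f = g := by
  suffices h : ∀ a, f (dehom 𝒜 hz a) = g (dehom 𝒜 hz a) by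
    ext a
    obtain ⟨a, rfl⟩ := dehom_surjective 𝒜 hz a
    exact h a
  intro a
  have ha : a ∈ Algebra.adjoin k (Set.range x) := hx ▸ Algebra.mem_top
  induction ha using Algebra.adjoin_induction with
  | mem a ha =>
    obtain ⟨i, rfl⟩ := ha
    exact h₁ i
  | algebraMap c => exact h₀ c
  | add a b _ _ ha hb => simp only [map_add, ha, hb]
  | mul a b _ _ ha hb => simp only [map_mul, ha, hb]

/-- A ring homomorphism `A →+* T` sending `z` to `1` factors through `A_(z)`. -/
def awayDesc {T : Type} [CommRing T] {z : A} (φ : A →+* T) (hφ : φ z = 1) : Away 𝒜 z →+* T :=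
  (IsLocalization.Away.lift (S := Localization.Away z) z (g := φ) (by simp [hφ])).comp
    (algebraMap (Away 𝒜 z) (Localization.Away z))

theorem awayDesc_dehom {T : Type} [CommRing T] {z : A} (hz : z ∈ 𝒜 1) (φ : A →+* T)
    (hφ : φ z = 1) (a : A) : awayDesc 𝒜 φ hφ (dehom 𝒜 hz a) = φ a := by
  classical
  rw [← DirectSum.sum_support_decompose 𝒜 a]
  simp only [map_sum]
  refine Finset.sum_congr rfl fun n _ => ?_
  rw [awayDesc, RingHom.comp_apply, HomogeneousLocalization.algebraMap_apply,
    dehom_val 𝒜 hz (SetLike.coe_mem _),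
    Localization.mk_eq_mk', IsLocalization.Away.lift, IsLocalization.lift_mk'_spec]
  simp [hφ]

variable {𝒜} in
theorem away_map_dehom {k' B : Type} [CommRing k'] [CommRing B] [Algebra k' B]
    {ℬ : ℕ → Submodule k' B} [GradedAlgebra ℬ] (g : GradedRingHom 𝒜 ℬ) {z : A} (hz : z ∈ 𝒜 1)
    (hz' : g z ∈ ℬ 1) (a : A) :
    Away.map g z (dehom 𝒜 hz a) = dehom ℬ hz' (g a) := by
  classical
  rw [← DirectSum.sum_support_decompose 𝒜 a]
  simp only [map_sum]
  refine Finset.sum_congr rfl fun n _ => ?_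
  have h : (DirectSum.decompose 𝒜 a n : A) ∈ 𝒜 n := SetLike.coe_mem _
  have h' : g (DirectSum.decompose 𝒜 a n : A) ∈ ℬ n := g.map_mem h
  rw [dehom_of_mem 𝒜 hz h, dehom_of_mem ℬ hz' h', Away.map_mk]

/-- A ring homomorphism between graded rings generated in degree one preserves the gradings as
soon as it preserves the degrees of the generators. -/
theorem map_mem_of_generators {k' B ι : Type} [CommRing k'] [CommRing B] [Algebra k' B]
    {ℬ : ℕ → Submodule k' B} [GradedAlgebra ℬ] {x : ι → A}
    (hx : Algebra.adjoin k (Set.range x) = ⊤) (hx1 : ∀ i, x i ∈ 𝒜 1) (φ : A →+* B)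
    (h₀ : ∀ c, φ (algebraMap k A c) ∈ ℬ 0) (h₁ : ∀ i, φ (x i) ∈ ℬ 1) {n : ℕ} {a : A}
    (ha : a ∈ 𝒜 n) : φ a ∈ ℬ n := by
  have key : ∀ m ∈ Submonoid.closure (Set.range x), ∃ d, m ∈ 𝒜 d ∧ φ m ∈ ℬ d := by
    intro m hm
    induction hm using Submonoid.closure_induction with
    | mem m hm =>
      obtain ⟨i, rfl⟩ := hm
      exact ⟨1, hx1 i, h₁ i⟩
    | one => exact ⟨0, SetLike.GradedOne.one_mem, by rw [map_one]; exact SetLike.GradedOne.one_mem⟩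
    | mul a b _ _ ha hb =>
      obtain ⟨d, hd, hd'⟩ := ha
      obtain ⟨e, he, he'⟩ := hb
      exact ⟨d + e, SetLike.GradedMul.mul_mem hd he,
        by rw [map_mul]; exact SetLike.GradedMul.mul_mem hd' he'⟩
  have main : ∀ a : A, ∀ n, φ (DirectSum.decompose 𝒜 a n) ∈ ℬ n := by
    intro a n
    have ha : a ∈ Submodule.span k (Submonoid.closure (Set.range x) : Set A) := by
      rw [← Algebra.adjoin_eq_span, hx]
      trivial
    induction ha using Submodule.span_induction with
    | mem m hm =>
      obtain ⟨d, hd, hd'⟩ := key m hm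
      by_cases hdn : d = n
      · subst hdn
        rwa [DirectSum.decompose_of_mem_same 𝒜 hd]
      · rw [DirectSum.decompose_of_mem_ne 𝒜 hd hdn, map_zero]
        exact zero_mem _
    | zero => simp
    | add a b _ _ ha hb =>
      rw [DirectSum.decompose_add, DirectSum.add_apply, Submodule.coe_add, map_add]
      exact add_mem ha hb
    | smul c a _ ha =>
      rw [DirectSum.decompose_smul, DirectSum.smul_apply, Submodule.coe_smul, Algebra.smul_def,
        map_mul]
      simpa using SetLike.GradedMul.mul_mem (h₀ c) ha
  have := main a n
  rwa [DirectSum.decompose_of_mem_same 𝒜 ha] at this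

/-- The graded ring homomorphism given by `map_mem_of_generators`. -/
def gradedHomOfGenerators {k' B ι : Type} [CommRing k'] [CommRing B] [Algebra k' B]
    {ℬ : ℕ → Submodule k' B} [GradedAlgebra ℬ] {x : ι → A}
    (hx : Algebra.adjoin k (Set.range x) = ⊤) (hx1 : ∀ i, x i ∈ 𝒜 1) (φ : A →+* B)
    (h₀ : ∀ c, φ (algebraMap k A c) ∈ ℬ 0) (h₁ : ∀ i, φ (x i) ∈ ℬ 1) :
    GradedRingHom 𝒜 ℬ where
  toRingHom := φ
  map_mem ha := map_mem_of_generators 𝒜 hx hx1 φ h₀ h₁ ha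

/-- The irrelevant ideal is generated by generators of degree one. -/
theorem irrelevant_le_span {ι : Type} {x : ι → A} (hx : Algebra.adjoin k (Set.range x) = ⊤)
    (hx1 : ∀ i, x i ∈ 𝒜 1) :
    (HomogeneousIdeal.irrelevant 𝒜).toIdeal ≤ Ideal.span (Set.range x) := by
  have main : ∀ a : A, ∃ c, a - algebraMap k A c ∈ Ideal.span (Set.range x) := by
    intro a
    have ha : a ∈ Algebra.adjoin k (Set.range x) := hx ▸ Algebra.mem_top
    induction ha using Algebra.adjoin_induction with
    | mem a ha => exact ⟨0, by simpa using Ideal.subset_span ha⟩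
    | algebraMap c => exact ⟨c, by simp⟩
    | add a b _ _ ha hb =>
      obtain ⟨c, hc⟩ := ha
      obtain ⟨d, hd⟩ := hb
      refine ⟨c + d, ?_⟩
      rw [map_add, add_sub_add_comm]
      exact add_mem hc hd
    | mul a b _ _ ha hb =>
      obtain ⟨c, hc⟩ := ha
      obtain ⟨d, hd⟩ := hb
      refine ⟨c * d, ?_⟩
      have : a * b - algebraMap k A (c * d) =
          b * (a - algebraMap k A c) + algebraMap k A c * (b - algebraMap k A d) := by
        rw [map_mul]
        ring
      rw [this]
      exact add_mem (Ideal.mul_mem_left _ _ hc) (Ideal.mul_mem_left _ _ hd)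
  have hhom : (Ideal.span (Set.range x)).IsHomogeneous 𝒜 :=
    Ideal.homogeneous_span _ _ (by
      rintro _ ⟨i, rfl⟩
      exact ⟨1, hx1 i⟩)
  intro a ha
  obtain ⟨c, hc⟩ := main a
  classical
  rw [← DirectSum.sum_support_decompose 𝒜 a]
  refine Ideal.sum_mem _ fun n _ => ?_
  by_cases hn : n = 0
  · subst hn
    have : (DirectSum.decompose 𝒜 a 0 : A) = 0 := by
      simpa [HomogeneousIdeal.mem_irrelevant_iff] using ha
    rw [this]
    exact zero_mem _
  · have h := hhom n hc
    have hcm : algebraMap k A c ∈ 𝒜 0 := SetLike.algebraMap_mem_graded 𝒜 c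
    rw [DirectSum.decompose_sub, DirectSum.sub_apply, Submodule.coe_sub,
      DirectSum.decompose_of_mem_ne 𝒜 hcm (Ne.symm hn), sub_zero] at h
    exact h

end Dehom

/-! ### Fibre products described by charts -/

section Charts

/-- A morphism is an isomorphism if it is injective, and its restrictions to the members of a
family of open immersions covering the source are open immersions covering the target. -/
theorem isIso_of_charts {ι : Type} {X Y : Scheme.{0}} (l : X ⟶ Y) {W : ι → Scheme.{0}}
    (c : ∀ i, W i ⟶ X) [∀ i, IsOpenImmersion (c i)] [hcl : ∀ i, IsOpenImmersion (c i ≫ l)]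
    (hc : ∀ x, ∃ i, x ∈ Set.range (c i)) (hl : ∀ y, ∃ i, y ∈ Set.range (c i ≫ l))
    (hinj : Function.Injective l) : IsIso l := by
  have hsurj : Function.Surjective l := by
    intro y
    obtain ⟨i, w, rfl⟩ := hl y
    exact ⟨c i w, by simp⟩
  have hopen : IsOpenMap l := by
    intro U hU
    have : l '' U = ⋃ i, (c i ≫ l) '' ((c i) ⁻¹' U) := by
      ext y
      simp only [Set.mem_image, Set.mem_iUnion, Set.mem_preimage]
      constructor
      · rintro ⟨x, hx, rfl⟩
        obtain ⟨i, w, rfl⟩ := hc x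
        exact ⟨i, w, hx, by simp⟩
      · rintro ⟨i, w, hw, rfl⟩
        exact ⟨c i w, hw, by simp⟩
    rw [this]
    exact isOpen_iUnion fun i =>
      (c i ≫ l).isOpenEmbedding.isOpenMap _ (hU.preimage (c i).continuous)
  have hemb : Topology.IsOpenEmbedding l :=
    .of_continuous_injective_isOpenMap l.continuous hinj hopen
  have hst : ∀ x, IsIso (l.stalkMap x) := by
    intro x
    obtain ⟨i, w, rfl⟩ := hc x
    have h := Scheme.Hom.stalkMap_comp (c i) l w
    have h2 : IsIso (l.stalkMap (c i w) ≫ (c i).stalkMap w) :=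
      h ▸ (IsOpenImmersion.iff_isIso_stalkMap.1 (hcl i)).2 w
    exact IsIso.of_isIso_comp_right _ ((c i).stalkMap w)
  have : IsOpenImmersion l := .of_isIso_stalkMap l hemb
  have : Epi l.base := (TopCat.epi_iff_surjective _).2 hsurj
  exact IsOpenImmersion.isIso l

theorem isPullback_of_charts {ι κ : Type} {P X Y B : Scheme.{0}} {p₁ : P ⟶ X} {p₂ : P ⟶ Y}
    {f : X ⟶ B} {g : Y ⟶ B} (w : p₁ ≫ f = p₂ ≫ g) {U : ι → Scheme.{0}} {V : κ → Scheme.{0}}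
    {W : ι → κ → Scheme.{0}} (u : ∀ i, U i ⟶ X) (v : ∀ j, V j ⟶ Y) (c : ∀ i j, W i j ⟶ P)
    [∀ i, IsOpenImmersion (u i)] [∀ j, IsOpenImmersion (v j)] [∀ i j, IsOpenImmersion (c i j)]
    (hu : ∀ x, ∃ i, x ∈ Set.range (u i)) (hv : ∀ y, ∃ j, y ∈ Set.range (v j))
    (a : ∀ i j, W i j ⟶ U i) (b : ∀ i j, W i j ⟶ V j)
    (h : ∀ i j, IsPullback (a i j) (b i j) (u i ≫ f) (v j ≫ g))
    (ha : ∀ i j, c i j ≫ p₁ = a i j ≫ u i) (hb : ∀ i j, c i j ≫ p₂ = b i j ≫ v j)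
    (hc : ∀ i j x, p₁ x ∈ Set.range (u i) → p₂ x ∈ Set.range (v j) → x ∈ Set.range (c i j)) :
    IsPullback p₁ p₂ f g := by
  obtain ⟨l, hl₁, hl₂⟩ : ∃ l : P ⟶ Limits.pullback f g,
      l ≫ Limits.pullback.fst f g = p₁ ∧ l ≫ Limits.pullback.snd f g = p₂ :=
    ⟨Limits.pullback.lift p₁ p₂ w, Limits.pullback.lift_fst _ _ _, Limits.pullback.lift_snd _ _ _⟩
  let m (i : ι) (j : κ) : Limits.pullback (u i ≫ f) (v j ≫ g) ⟶ Limits.pullback f g :=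
    Limits.pullback.map _ _ _ _ (u i) (v j) (𝟙 B) (by simp) (by simp)
  have hm : ∀ i j, c i j ≫ l = (h i j).isoPullback.hom ≫ m i j := by
    intro i j
    ext1
    · rw [Category.assoc, Category.assoc, hl₁, ha, Limits.pullback.lift_fst,
        IsPullback.isoPullback_hom_fst_assoc]
    · rw [Category.assoc, Category.assoc, hl₂, hb, Limits.pullback.lift_snd,
        IsPullback.isoPullback_hom_snd_assoc]
  have hml : ∀ i j, IsOpenImmersion (c i j ≫ l) := by
    intro i j
    rw [hm]
    infer_instance
  have hrange : ∀ i j, Set.range (c i j ≫ l) =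
      Limits.pullback.fst f g ⁻¹' Set.range (u i) ∩
        Limits.pullback.snd f g ⁻¹' Set.range (v j) := by
    intro i j
    rw [hm, ← Scheme.Pullback.range_map (u i ≫ f) (v j ≫ g) f g (u i) (v j) (𝟙 B)
        (by simp) (by simp)]
    simp only [Scheme.Hom.comp_base, TopCat.hom_comp, ContinuousMap.coe_comp]
    exact (h i j).isoPullback.hom.surjective.range_comp _
  have hl1 : ∀ x, Limits.pullback.fst f g (l x) = p₁ x := fun x => by
    rw [← Scheme.Hom.comp_apply, hl₁]
  have hl2 : ∀ x, Limits.pullback.snd f g (l x) = p₂ x := fun x => by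
    rw [← Scheme.Hom.comp_apply, hl₂]
  have : IsIso l := by
    refine isIso_of_charts (ι := ι × κ) l (fun ij => c ij.1 ij.2) ?_ ?_ ?_
    · intro x
      obtain ⟨i, hi⟩ := hu (p₁ x)
      obtain ⟨j, hj⟩ := hv (p₂ x)
      exact ⟨(i, j), hc i j x hi hj⟩
    · intro y
      obtain ⟨i, hi⟩ := hu (Limits.pullback.fst f g y)
      obtain ⟨j, hj⟩ := hv (Limits.pullback.snd f g y)
      refine ⟨(i, j), ?_⟩
      rw [hrange]
      exact ⟨hi, hj⟩
    · intro x x' hxx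
      obtain ⟨i, hi⟩ := hu (p₁ x)
      obtain ⟨j, hj⟩ := hv (p₂ x)
      obtain ⟨y, rfl⟩ := hc i j x hi hj
      obtain ⟨y', rfl⟩ := hc i j x' (by rwa [← hl1, ← hxx, hl1]) (by rwa [← hl2, ← hxx, hl2])
      have := (c i j ≫ l).isOpenEmbedding.injective (a₁ := y) (a₂ := y') (by simpa using hxx)
      rw [this]
  exact IsPullback.of_iso_pullback ⟨w⟩ (asIso l) hl₁ hl₂

end Charts

/-! ### Morphisms between projective spectra -/

section ProjMorphisms

variable {k A : Type} [CommRing k] [CommRing A] [Algebra k A] (𝒜 : ℕ → Submodule k A)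
  [GradedAlgebra 𝒜]

/-- The structure morphism of the projective spectrum of a graded `k`-algebra. -/
def projToSpec : Proj 𝒜 ⟶ Spec (.of k) :=
  Proj.toSpecZero 𝒜 ≫ Spec.map (CommRingCat.ofHom (algebraMap k (𝒜 0)))

theorem awayι_projToSpec {z : A} (hz : z ∈ 𝒜 1) :
    Proj.awayι 𝒜 z hz one_pos ≫ projToSpec 𝒜 =
      Spec.map (CommRingCat.ofHom ((dehom 𝒜 hz).comp (algebraMap k A))) := by
  rw [projToSpec, Proj.awayι_toSpecZero_assoc, ← Spec.map_comp, ← CommRingCat.ofHom_comp]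
  congr 2
  ext c
  have hc : algebraMap k A c ∈ 𝒜 0 := SetLike.algebraMap_mem_graded 𝒜 c
  rw [RingHom.comp_apply, RingHom.comp_apply, dehom_val 𝒜 hz hc]
  change Localization.mk _ _ = _
  congr 1
  ext
  simp

theorem exists_mem_range_awayι {ι : Type} {x : ι → A} (hx : Algebra.adjoin k (Set.range x) = ⊤)
    (hx1 : ∀ i, x i ∈ 𝒜 1) (y : Proj 𝒜) :
    ∃ i, y ∈ Set.range (Proj.awayι 𝒜 (x i) (hx1 i) one_pos) := by
  have h := Proj.iSup_basicOpen_eq_top 𝒜 x (irrelevant_le_span 𝒜 hx hx1)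
  obtain ⟨i, hi⟩ := TopologicalSpace.Opens.mem_iSup.1 (h.ge (Set.mem_univ y))
  refine ⟨i, ?_⟩
  rw [← Proj.opensRange_awayι 𝒜 (x i) (hx1 i) one_pos] at hi
  exact hi

theorem proj_hom_ext {ι : Type} {x : ι → A} (hx : Algebra.adjoin k (Set.range x) = ⊤)
    (hx1 : ∀ i, x i ∈ 𝒜 1) {Y : Scheme.{0}} {f g : Proj 𝒜 ⟶ Y}
    (h : ∀ i, Proj.awayι 𝒜 (x i) (hx1 i) one_pos ≫ f = Proj.awayι 𝒜 (x i) (hx1 i) one_pos ≫ g) :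
    f = g :=
  (Proj.affineOpenCoverOfIrrelevantLESpan 𝒜 x hx1 (fun _ => one_pos)
    (irrelevant_le_span 𝒜 hx hx1)).openCover.hom_ext _ _ h

/-- Morphisms given on the standard charts of a projective spectrum glue if they agree on the
overlaps. -/
theorem proj_exists_glue {ι : Type} {x : ι → A} (hx : Algebra.adjoin k (Set.range x) = ⊤)
    (hx1 : ∀ i, x i ∈ 𝒜 1) {Y : Scheme.{0}}
    (f : ∀ i, Spec (.of (HomogeneousLocalization.Away 𝒜 (x i))) ⟶ Y)
    (h : ∀ i j, Spec.map (CommRingCat.ofHom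
        (HomogeneousLocalization.awayMap 𝒜 (hx1 j) (rfl : x i * x j = x i * x j))) ≫ f i =
      Spec.map (CommRingCat.ofHom
        (HomogeneousLocalization.awayMap 𝒜 (hx1 i) (mul_comm (x i) (x j)))) ≫ f j) :
    ∃ F : Proj 𝒜 ⟶ Y, ∀ i, Proj.awayι 𝒜 (x i) (hx1 i) one_pos ≫ F = f i := by
  let 𝒰 := (Proj.affineOpenCoverOfIrrelevantLESpan 𝒜 x hx1 (fun _ => one_pos)
    (irrelevant_le_span 𝒜 hx hx1)).openCover
  have hf : ∀ i j : ι, Limits.pullback.fst (Proj.awayι 𝒜 (x i) (hx1 i) one_pos)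
      (Proj.awayι 𝒜 (x j) (hx1 j) one_pos) ≫ f i =
      Limits.pullback.snd (Proj.awayι 𝒜 (x i) (hx1 i) one_pos)
        (Proj.awayι 𝒜 (x j) (hx1 j) one_pos) ≫ f j := by
    intro i j
    rw [← Proj.pullbackAwayιIso_hom_SpecMap_awayMap_left 𝒜 (hx1 i) one_pos (hx1 j) one_pos rfl,
      ← Proj.pullbackAwayιIso_hom_SpecMap_awayMap_right 𝒜 (hx1 i) one_pos (hx1 j) one_pos rfl,
      Category.assoc, Category.assoc, h i j]
  exact ⟨𝒰.glueMorphisms f hf, fun i => 𝒰.ι_glueMorphisms f hf i⟩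

theorem mem_range_awayι {z : A} (hz : z ∈ 𝒜 1) (y : Proj 𝒜) :
    y ∈ Set.range (Proj.awayι 𝒜 z hz one_pos) ↔ y ∈ Proj.basicOpen 𝒜 z := by
  rw [← Proj.opensRange_awayι 𝒜 z hz one_pos]
  rfl

end ProjMorphisms

section BaseChange

open HomogeneousLocalization

/-- A square of affine schemes is cartesian if the square of rings has the universal property of
a pushout. -/
theorem isPullback_SpecMap_of_universal {R B C D : Type} [CommRing R] [CommRing B] [CommRing C]
    [CommRing D] {f : R →+* B} {g : R →+* C} {i : B →+* D} {j : C →+* D}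
    (w : i.comp f = j.comp g)
    (ex : ∀ (T : Type) [CommRing T] (a : B →+* T) (b : C →+* T), a.comp f = b.comp g →
      ∃ h : D →+* T, h.comp i = a ∧ h.comp j = b)
    (uniq : ∀ (T : Type) [CommRing T] (h h' : D →+* T), h.comp i = h'.comp i →
      h.comp j = h'.comp j → h = h') :
    IsPullback (Spec.map (CommRingCat.ofHom i)) (Spec.map (CommRingCat.ofHom j))
      (Spec.map (CommRingCat.ofHom f)) (Spec.map (CommRingCat.ofHom g)) := by
  apply isPullback_SpecMap_of_isPushout
  have ex' : ∀ s : Limits.PushoutCocone (CommRingCat.ofHom f) (CommRingCat.ofHom g),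
      ∃ h : D →+* s.pt, h.comp i = s.inl.hom ∧ h.comp j = s.inr.hom := fun s =>
    ex s.pt s.inl.hom s.inr.hom (congrArg CommRingCat.Hom.hom s.condition)
  choose h h₁ h₂ using ex'
  refine ⟨⟨by rw [← CommRingCat.ofHom_comp, ← CommRingCat.ofHom_comp, w]⟩,
    ⟨Limits.PushoutCocone.IsColimit.mk _ (fun s => CommRingCat.ofHom (h s)) ?_ ?_ ?_⟩⟩
  · intro s
    ext x
    exact congrArg (fun φ : B →+* s.pt => φ x) (h₁ s)
  · intro s
    ext x
    exact congrArg (fun φ : C →+* s.pt => φ x) (h₂ s)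
  · intro s m hm₁ hm₂
    apply CommRingCat.hom_ext
    refine uniq _ _ _ ?_ ?_
    · exact (congrArg CommRingCat.Hom.hom hm₁).trans (h₁ s).symm
    · exact (congrArg CommRingCat.Hom.hom hm₂).trans (h₂ s).symm

variable {k k' A S ι : Type} [CommRing k] [CommRing k'] [CommRing A] [CommRing S]
  [Algebra k A] [Algebra k' S] {𝒜 : ℕ → Submodule k A} [GradedAlgebra 𝒜]
  {𝒮 : ℕ → Submodule k' S} [GradedAlgebra 𝒮]

theorem irrelevant_le_map_of_generators (φ : GradedRingHom 𝒜 𝒮) {x : ι → A}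
    (hx1 : ∀ i, x i ∈ 𝒜 1) (hS : Algebra.adjoin k' (Set.range fun i => φ (x i)) = ⊤) :
    HomogeneousIdeal.irrelevant 𝒮 ≤ (HomogeneousIdeal.irrelevant 𝒜).map φ := by
  intro a ha
  have h := irrelevant_le_span 𝒮 hS (fun i => φ.map_mem (hx1 i)) ha
  refine (Ideal.span_le.2 ?_ : Ideal.span _ ≤
    ((HomogeneousIdeal.irrelevant 𝒜).map φ).toIdeal) h
  rintro _ ⟨i, rfl⟩
  exact Ideal.mem_map_of_mem φ (HomogeneousIdeal.mem_irrelevant_of_mem _ one_pos (hx1 i))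

/-- Base change for projective spectra of graded algebras generated in degree one. -/
theorem isPullback_proj_map (ρ : k →+* k') (φ : GradedRingHom 𝒜 𝒮)
    (hφ : ∀ c, φ (algebraMap k A c) = algebraMap k' S (ρ c)) {x : ι → A}
    (hx : Algebra.adjoin k (Set.range x) = ⊤) (hx1 : ∀ i, x i ∈ 𝒜 1)
    (hS : Algebra.adjoin k' (Set.range fun i => φ (x i)) = ⊤)
    (univ : ∀ (T : Type) [CommRing T] (a : A →+* T) (b : k' →+* T),
      (∀ c, a (algebraMap k A c) = b (ρ c)) →
        ∃ h : S →+* T, (∀ i, h (φ (x i)) = a (x i)) ∧ ∀ c, h (algebraMap k' S c) = b c) :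
    IsPullback (Proj.map φ (irrelevant_le_map_of_generators φ hx1 hS)) (projToSpec 𝒮)
      (projToSpec 𝒜) (Spec.map (CommRingCat.ofHom ρ)) := by
  have hz1 : ∀ i, φ (x i) ∈ 𝒮 1 := fun i => φ.map_mem (hx1 i)
  have hc : ∀ i, Proj.awayι 𝒮 (φ (x i)) (hz1 i) one_pos ≫
      Proj.map φ (irrelevant_le_map_of_generators φ hx1 hS) =
      Spec.map (CommRingCat.ofHom (Away.map φ (x i))) ≫ Proj.awayι 𝒜 (x i) (hx1 i) one_pos :=
    fun i => Proj.awayι_comp_map φ _ one_pos (x i) (hx1 i)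
  have hring : ∀ i, (Away.map φ (x i)).comp ((dehom 𝒜 (hx1 i)).comp (algebraMap k A)) =
      ((dehom 𝒮 (hz1 i)).comp (algebraMap k' S)).comp ρ := by
    intro i
    ext c
    simp only [RingHom.comp_apply]
    rw [away_map_dehom φ (hx1 i) (hz1 i), hφ]
  have hw : Proj.map φ (irrelevant_le_map_of_generators φ hx1 hS) ≫ projToSpec 𝒜 =
      projToSpec 𝒮 ≫ Spec.map (CommRingCat.ofHom ρ) := by
    refine proj_hom_ext 𝒮 hS hz1 fun i => ?_
    rw [reassoc_of% (hc i), awayι_projToSpec, reassoc_of% (awayι_projToSpec 𝒮 (hz1 i)),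
      ← Spec.map_comp, ← Spec.map_comp, ← CommRingCat.ofHom_comp, ← CommRingCat.ofHom_comp, hring]
  refine isPullback_of_charts (ι := ι) (κ := Unit) hw
    (fun i => Proj.awayι 𝒜 (x i) (hx1 i) one_pos) (fun _ => 𝟙 _)
    (fun i _ => Proj.awayι 𝒮 (φ (x i)) (hz1 i) one_pos)
    (exists_mem_range_awayι 𝒜 hx hx1) (fun y => ⟨(), y, rfl⟩)
    (fun i _ => Spec.map (CommRingCat.ofHom (Away.map φ (x i))))
    (fun i _ => Spec.map (CommRingCat.ofHom ((dehom 𝒮 (hz1 i)).comp (algebraMap k' S))))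
    ?_ (fun i _ => hc i) (fun i _ => ?_) ?_
  · intro i _
    rw [awayι_projToSpec, Category.id_comp]
    refine isPullback_SpecMap_of_universal (hring i) ?_ ?_
    · intro T _ a b hab
      obtain ⟨h, h₁, h₂⟩ := univ T (a.comp (dehom 𝒜 (hx1 i))) b
        (fun c => congrArg (fun f : k →+* T => f c) hab)
      have h1 : h (φ (x i)) = 1 := by
        rw [h₁, RingHom.comp_apply, dehom_self, map_one]
      refine ⟨awayDesc 𝒮 h h1, ?_, ?_⟩
      · refine away_hom_ext 𝒜 hx (hx1 i) (fun c => ?_) (fun m => ?_)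
        · rw [RingHom.comp_apply, away_map_dehom φ (hx1 i) (hz1 i), awayDesc_dehom, hφ, h₂]
          exact (congrArg (fun f : k →+* T => f c) hab).symm
        · rw [RingHom.comp_apply, away_map_dehom φ (hx1 i) (hz1 i), awayDesc_dehom, h₁]
          rfl
      · ext c
        rw [RingHom.comp_apply, RingHom.comp_apply, awayDesc_dehom, h₂]
    · intro T _ h h' e₁ e₂
      refine away_hom_ext 𝒮 hS (hz1 i) (fun c => ?_) (fun m => ?_)
      · exact congrArg (fun f : k' →+* T => f c) e₂
      · have := congrArg (fun f : Away 𝒜 (x i) →+* T => f (dehom 𝒜 (hx1 i) (x m))) e₁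
        simpa only [RingHom.comp_apply, away_map_dehom φ (hx1 i) (hz1 i)] using this
  · rw [awayι_projToSpec, Category.comp_id]
  · intro i _ y hy _
    rw [mem_range_awayι] at hy ⊢
    exact hy

end BaseChange

section Segre

open HomogeneousLocalization

section

variable {k A : Type} [CommRing k] [CommRing A] [Algebra k A] (𝒜 : ℕ → Submodule k A)
  [GradedAlgebra 𝒜] {z z' : A} (hz : z ∈ 𝒜 1)

theorem isLocalizationElem_eq_dehom (hz' : z' ∈ 𝒜 1) :
    Away.isLocalizationElem hz hz' = dehom 𝒜 hz z' := by
  rw [dehom_of_mem 𝒜 hz hz']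
  ext
  simp

theorem awayMap_dehom (hz' : z' ∈ 𝒜 1) {n : ℕ} {a : A} (ha : a ∈ 𝒜 n) :
    awayMap 𝒜 hz' (rfl : z * z' = z * z') (dehom 𝒜 hz a) =
      awayMap 𝒜 hz' (rfl : z * z' = z * z') (dehom 𝒜 hz z') ^ n *
        awayMap 𝒜 hz (mul_comm z z') (dehom 𝒜 hz' a) := by
  simp only [dehom_of_mem 𝒜 hz ha, dehom_of_mem 𝒜 hz hz', dehom_of_mem 𝒜 hz' ha, awayMap_mk]
  ext
  simp only [Away.val_mk, val_mul, val_pow, Localization.mk_pow, Localization.mk_mul,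
    Localization.mk_eq_mk_iff, Localization.r_iff_exists]
  refine ⟨1, ?_⟩
  simp only [OneMemClass.coe_one, one_mul, Submonoid.coe_mul, SubmonoidClass.mk_pow]
  ring

theorem awayι_mem_basicOpen_iff (hz' : z' ∈ 𝒜 1) (w : Spec (.of (Away 𝒜 z))) :
    Proj.awayι 𝒜 z hz one_pos w ∈ Proj.basicOpen 𝒜 z' ↔ dehom 𝒜 hz z' ∉ w.asIdeal := by
  rw [← isLocalizationElem_eq_dehom 𝒜 hz hz']
  have h := Proj.awayι_preimage_basicOpen 𝒜 hz one_pos hz' one_pos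
  exact (congrArg (fun U : (Spec (.of (Away 𝒜 z))).Opens => w ∈ U) h).to_iff

end

variable {k A ι : Type} [CommRing k] [CommRing A] [Algebra k A] {𝒜 : ℕ → Submodule k A}
  [GradedAlgebra 𝒜]

/-- Two ring-valued points in standard charts of a projective spectrum agree if their homogeneous
coordinates are proportional. -/
theorem SpecMap_awayι_eq {x : ι → A} (hx : Algebra.adjoin k (Set.range x) = ⊤)
    (hx1 : ∀ i, x i ∈ 𝒜 1) {z z' : A} (hz : z ∈ 𝒜 1) (hz' : z' ∈ 𝒜 1)
    {R : Type} [CommRing R] (a : Away 𝒜 z →+* R)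
    (b : Away 𝒜 z' →+* R) (t : R) (hu : IsUnit t) (ht : a (dehom 𝒜 hz z') = t)
    (h₀ : ∀ c, a (dehom 𝒜 hz (algebraMap k A c)) = b (dehom 𝒜 hz' (algebraMap k A c)))
    (h₁ : ∀ i, a (dehom 𝒜 hz (x i)) = t * b (dehom 𝒜 hz' (x i))) :
    Spec.map (CommRingCat.ofHom a) ≫ Proj.awayι 𝒜 z hz one_pos =
      Spec.map (CommRingCat.ofHom b) ≫ Proj.awayι 𝒜 z' hz' one_pos := by
  have hzz : z * z' ∈ 𝒜 (1 + 1) := SetLike.GradedMul.mul_mem hz hz'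
  let e := awayMap 𝒜 hz' (rfl : z * z' = z * z')
  let e' := awayMap 𝒜 hz (mul_comm z z')
  have hloc := Away.isLocalization_mul hz hz' (rfl : z * z' = z * z') one_ne_zero
  let _ : Algebra (Away 𝒜 z) (Away 𝒜 (z * z')) := e.toAlgebra
  rw [isLocalizationElem_eq_dehom] at hloc
  have hunit : IsUnit (a (dehom 𝒜 hz z')) := ht ▸ hu
  let c : Away 𝒜 (z * z') →+* R := IsLocalization.Away.lift (dehom 𝒜 hz z') hunit
  have hce : c.comp e = a := by
    ext y
    exact IsLocalization.Away.lift_eq (dehom 𝒜 hz z') hunit y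
  have hce' : ∀ h ∈ 𝒜 1, c (e (dehom 𝒜 hz h)) = a (dehom 𝒜 hz z') * c (e' (dehom 𝒜 hz' h)) := by
    intro h hh
    rw [awayMap_dehom 𝒜 hz hz' hh, pow_one, map_mul, ← RingHom.comp_apply, hce]
  have hcb : c.comp e' = b := by
    refine away_hom_ext 𝒜 hx hz' (fun r => ?_) (fun i => ?_)
    · have h := congrArg c (awayMap_dehom 𝒜 hz hz' (SetLike.algebraMap_mem_graded 𝒜 r))
      rw [pow_zero, one_mul, ← RingHom.comp_apply, hce, h₀] at h
      exact h.symm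
    · have hr := hce' (x i) (hx1 i)
      rw [← RingHom.comp_apply, hce, h₁, ht] at hr
      exact (hu.mul_left_cancel hr).symm
  rw [← hce, ← hcb, CommRingCat.ofHom_comp, CommRingCat.ofHom_comp, Spec.map_comp, Spec.map_comp,
    Category.assoc, Category.assoc]
  congr 1
  exact (Proj.SpecMap_awayMap_awayι 𝒜 hz one_pos hz' rfl).trans
    (Proj.SpecMap_awayMap_awayι 𝒜 hz' one_pos hz (mul_comm z z')).symm


variable {S κ : Type} [CommRing S] [Algebra k S] {𝒮 : ℕ → Submodule k S} [GradedAlgebra 𝒮]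

/-- The morphism `Proj S ⟶ Proj A` which is given by the coordinates `(z i j)_i` wherever they do
not vanish simultaneously. -/
theorem exists_segre_proj {x : ι → A} (hx : Algebra.adjoin k (Set.range x) = ⊤)
    (hx1 : ∀ i, x i ∈ 𝒜 1) {z : ι → κ → S} (hz1 : ∀ i j, z i j ∈ 𝒮 1)
    (hz : Algebra.adjoin k (Set.range fun ij : ι × κ => z ij.1 ij.2) = ⊤)
    (α : κ → A →ₐ[k] S) (hα : ∀ i j, α j (x i) = z i j)
    (hminor : ∀ i j i' j', z i j * z i' j' = z i j' * z i' j) :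
    ∃ (p : Proj 𝒮 ⟶ Proj 𝒜) (f : ∀ i j, Away 𝒜 (x i) →+* Away 𝒮 (z i j)),
      (∀ i j a, f i j (dehom 𝒜 (hx1 i) a) = dehom 𝒮 (hz1 i j) (α j a)) ∧
      ∀ i j, Proj.awayι 𝒮 (z i j) (hz1 i j) one_pos ≫ p =
        Spec.map (CommRingCat.ofHom (f i j)) ≫ Proj.awayι 𝒜 (x i) (hx1 i) one_pos := by
  have h1 : ∀ i j, (dehom 𝒮 (hz1 i j)).comp (α j : A →+* S) (x i) = 1 := by
    intro i j
    rw [RingHom.comp_apply, RingHom.coe_coe, hα, dehom_self]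
  let f (i : ι) (j : κ) : Away 𝒜 (x i) →+* Away 𝒮 (z i j) := awayDesc 𝒜 _ (h1 i j)
  have hf : ∀ i j a, f i j (dehom 𝒜 (hx1 i) a) = dehom 𝒮 (hz1 i j) (α j a) :=
    fun i j a => awayDesc_dehom 𝒜 (hx1 i) _ (h1 i j) a
  obtain ⟨p, hp⟩ := proj_exists_glue 𝒮 hz (fun ij => hz1 ij.1 ij.2)
    (fun ij => Spec.map (CommRingCat.ofHom (f ij.1 ij.2)) ≫
      Proj.awayι 𝒜 (x ij.1) (hx1 ij.1) one_pos) (by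
    rintro ⟨i, j⟩ ⟨i', j'⟩
    dsimp only
    have rel := fun {n : ℕ} {a : S} (ha : a ∈ 𝒮 n) => awayMap_dehom 𝒮 (hz1 i j) (hz1 i' j') ha
    rw [← Spec.map_comp_assoc, ← Spec.map_comp_assoc, ← CommRingCat.ofHom_comp,
      ← CommRingCat.ofHom_comp]
    set e := awayMap 𝒮 (hz1 i' j') (rfl : z i j * z i' j' = z i j * z i' j')
    set e' := awayMap 𝒮 (hz1 i j) (mul_comm (z i j) (z i' j'))
    have hτ : IsUnit (e (dehom 𝒮 (hz1 i j) (z i' j'))) := by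
      have := rel (hz1 i j)
      rw [dehom_self, map_one, pow_one] at this
      exact .of_mul_eq_one _ this.symm
    have hmul : ∀ m, e (dehom 𝒮 (hz1 i j) (z m j)) * e (dehom 𝒮 (hz1 i j) (z i' j')) =
        e (dehom 𝒮 (hz1 i j) (z m j')) * e (dehom 𝒮 (hz1 i j) (z i' j)) := by
      intro m
      rw [← map_mul, ← map_mul, ← map_mul, ← map_mul]
      exact congrArg (fun s => e (dehom 𝒮 (hz1 i j) s)) (hminor m j i' j')
    refine SpecMap_awayι_eq hx hx1 (hx1 i) (hx1 i') _ _
      (e (dehom 𝒮 (hz1 i j) (z i' j))) ?_ ?_ ?_ ?_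
    · have := hmul i
      rw [dehom_self, map_one, one_mul] at this
      rw [this] at hτ
      exact isUnit_of_mul_isUnit_right hτ
    · rw [RingHom.comp_apply, hf, hα]
    · intro c
      rw [RingHom.comp_apply, RingHom.comp_apply, hf, hf, AlgHom.commutes, AlgHom.commutes,
        rel (SetLike.algebraMap_mem_graded 𝒮 c), pow_zero, one_mul]
    · intro m
      rw [RingHom.comp_apply, RingHom.comp_apply, hf, hf, hα, hα]
      refine hτ.mul_right_cancel ?_
      rw [hmul, rel (hz1 m j'), pow_one]
      ring)
  exact ⟨p, f, hf, fun i j => hp (i, j)⟩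

/-- The Segre product: `Proj S` is the product of `Proj A` and `Proj B` if `S` is generated by
elements `z i j` behaving like the products of the coordinates of `Proj A` and of `Proj B`. -/
theorem exists_isPullback_segre {B : Type} [CommRing B] [Algebra k B] {ℬ : ℕ → Submodule k B}
    [GradedAlgebra ℬ] {x : ι → A} (hx : Algebra.adjoin k (Set.range x) = ⊤)
    (hx1 : ∀ i, x i ∈ 𝒜 1) {y : κ → B} (hy : Algebra.adjoin k (Set.range y) = ⊤)
    (hy1 : ∀ i, y i ∈ ℬ 1) {z : ι → κ → S} (hz1 : ∀ i j, z i j ∈ 𝒮 1)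
    (hz : Algebra.adjoin k (Set.range fun ij : ι × κ => z ij.1 ij.2) = ⊤)
    (α : κ → A →ₐ[k] S) (hα : ∀ i j, α j (x i) = z i j)
    (β : ι → B →ₐ[k] S) (hβ : ∀ i j, β i (y j) = z i j)
    (hminor : ∀ i j i' j', z i j * z i' j' = z i j' * z i' j)
    (univ : ∀ (T : Type) [CommRing T] (a : A →+* T) (b : B →+* T),
      (∀ c, a (algebraMap k A c) = b (algebraMap k B c)) → ∃ h : S →+* T,
        (∀ i j, h (z i j) = a (x i) * b (y j)) ∧
          ∀ c, h (algebraMap k S c) = a (algebraMap k A c)) :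
    ∃ (p : Proj 𝒮 ⟶ Proj 𝒜) (q : Proj 𝒮 ⟶ Proj ℬ),
      IsPullback p q (projToSpec 𝒜) (projToSpec ℬ) ∧ p ≫ projToSpec 𝒜 = projToSpec 𝒮 := by
  obtain ⟨p, f, hf, hp⟩ := exists_segre_proj hx hx1 hz1 hz α hα hminor
  have hz' : Algebra.adjoin k (Set.range fun ji : κ × ι => z ji.2 ji.1) = ⊤ := by
    rw [← hz, ← (Equiv.prodComm ι κ).surjective.range_comp]
    rfl
  obtain ⟨q, g, hg, hq⟩ := exists_segre_proj (z := fun j i => z i j) hy hy1 (fun j i => hz1 i j) hz'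
    β (fun j i => hβ i j) (fun j i j' i' => by rw [hminor, mul_comm])
  have hpk : p ≫ projToSpec 𝒜 = projToSpec 𝒮 := by
    refine proj_hom_ext 𝒮 hz (fun ij => hz1 ij.1 ij.2) fun ij => ?_
    rw [reassoc_of% (hp ij.1 ij.2), awayι_projToSpec, awayι_projToSpec, ← Spec.map_comp,
      ← CommRingCat.ofHom_comp]
    congr 2
    ext c
    simp only [RingHom.comp_apply, hf, AlgHom.commutes]
  have hqk : q ≫ projToSpec ℬ = projToSpec 𝒮 := by
    refine proj_hom_ext 𝒮 hz (fun ij => hz1 ij.1 ij.2) fun ij => ?_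
    rw [reassoc_of% (hq ij.2 ij.1), awayι_projToSpec, awayι_projToSpec, ← Spec.map_comp,
      ← CommRingCat.ofHom_comp]
    congr 2
    ext c
    simp only [RingHom.comp_apply, hg, AlgHom.commutes]
  refine ⟨p, q, ?_, hpk⟩
  refine isPullback_of_charts (hpk.trans hqk.symm)
    (fun i => Proj.awayι 𝒜 (x i) (hx1 i) one_pos) (fun j => Proj.awayι ℬ (y j) (hy1 j) one_pos)
    (fun i j => Proj.awayι 𝒮 (z i j) (hz1 i j) one_pos)
    (exists_mem_range_awayι 𝒜 hx hx1) (exists_mem_range_awayι ℬ hy hy1)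
    (fun i j => Spec.map (CommRingCat.ofHom (f i j)))
    (fun i j => Spec.map (CommRingCat.ofHom (g j i)))
    ?_ hp (fun i j => hq j i) ?_
  · intro i j
    rw [awayι_projToSpec, awayι_projToSpec]
    have hw : (f i j).comp ((dehom 𝒜 (hx1 i)).comp (algebraMap k A)) =
        (g j i).comp ((dehom ℬ (hy1 j)).comp (algebraMap k B)) := by
      ext c
      simp only [RingHom.comp_apply, hf, hg, AlgHom.commutes]
    refine isPullback_SpecMap_of_universal hw ?_ ?_
    · intro T _ a b hab
      have hab' : ∀ c, a (dehom 𝒜 (hx1 i) (algebraMap k A c)) =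
        b (dehom ℬ (hy1 j) (algebraMap k B c)) := fun c => congrArg (fun f : k →+* T => f c) hab
      obtain ⟨h, h₁, h₂⟩ := univ T (a.comp (dehom 𝒜 (hx1 i))) (b.comp (dehom ℬ (hy1 j))) hab'
      simp only [RingHom.comp_apply] at h₁ h₂
      have h1 : h (z i j) = 1 := by
        rw [h₁, dehom_self, dehom_self, map_one, map_one, one_mul]
      refine ⟨awayDesc 𝒮 h h1, ?_, ?_⟩
      · refine away_hom_ext 𝒜 hx (hx1 i) (fun c => ?_) (fun m => ?_)
        · rw [RingHom.comp_apply, hf, awayDesc_dehom, AlgHom.commutes, h₂]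
        · rw [RingHom.comp_apply, hf, awayDesc_dehom, hα, h₁, dehom_self ℬ, map_one, mul_one]
      · refine away_hom_ext ℬ hy (hy1 j) (fun c => ?_) (fun m => ?_)
        · rw [RingHom.comp_apply, hg, awayDesc_dehom, AlgHom.commutes, h₂, hab']
        · rw [RingHom.comp_apply, hg, awayDesc_dehom, hβ, h₁, dehom_self 𝒜, map_one, one_mul]
    · intro T _ h h' e₁ e₂
      have e₁' : ∀ a, h (dehom 𝒮 (hz1 i j) (α j a)) = h' (dehom 𝒮 (hz1 i j) (α j a)) := by
        intro a
        have := congrArg (fun f : Away 𝒜 (x i) →+* T => f (dehom 𝒜 (hx1 i) a)) e₁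
        simpa only [RingHom.comp_apply, hf] using this
      have e₂' : ∀ a, h (dehom 𝒮 (hz1 i j) (β i a)) = h' (dehom 𝒮 (hz1 i j) (β i a)) := by
        intro a
        have := congrArg (fun f : Away ℬ (y j) →+* T => f (dehom ℬ (hy1 j) a)) e₂
        simpa only [RingHom.comp_apply, hg] using this
      refine away_hom_ext 𝒮 hz (hz1 i j) (fun c => ?_) ?_
      · simpa only [AlgHom.commutes] using e₁' (algebraMap k A c)
      · rintro ⟨m, n⟩
        have : dehom 𝒮 (hz1 i j) (z m n) =
            dehom 𝒮 (hz1 i j) (z m j) * dehom 𝒮 (hz1 i j) (z i n) := by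
          rw [← map_mul, hminor, map_mul, dehom_self, mul_one]
        dsimp only
        rw [this, map_mul, map_mul, ← hα m j, ← hβ i n, e₁', e₂']
  · intro i j t h₁ h₂
    obtain ⟨⟨i', j'⟩, w, rfl⟩ := exists_mem_range_awayι 𝒮 hz (fun ij => hz1 ij.1 ij.2) t
    dsimp only at w h₁ h₂ ⊢
    rw [mem_range_awayι, ← Scheme.Hom.comp_apply] at h₁ h₂
    rw [hp, Scheme.Hom.comp_apply, awayι_mem_basicOpen_iff 𝒜 _ (hx1 i)] at h₁
    rw [hq j' i', Scheme.Hom.comp_apply, awayι_mem_basicOpen_iff ℬ _ (hy1 j)] at h₂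
    rw [mem_range_awayι, awayι_mem_basicOpen_iff 𝒮 _ (hz1 i j)]
    have h₁' : dehom 𝒮 (hz1 i' j') (z i j') ∉ w.asIdeal := by
      have e : f i' j' (dehom 𝒜 (hx1 i') (x i)) = dehom 𝒮 (hz1 i' j') (z i j') := by rw [hf, hα]
      exact e ▸ h₁
    have h₂' : dehom 𝒮 (hz1 i' j') (z i' j) ∉ w.asIdeal := by
      have e : g j' i' (dehom ℬ (hy1 j') (y j)) = dehom 𝒮 (hz1 i' j') (z i' j) := by rw [hg, hβ]
      exact e ▸ h₂
    intro hw
    have : dehom 𝒮 (hz1 i' j') (z i j) =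
        dehom 𝒮 (hz1 i' j') (z i j') * dehom 𝒮 (hz1 i' j') (z i' j) := by
      rw [← map_mul, ← hminor, map_mul, dehom_self, mul_one]
    rw [this] at hw
    exact (w.isPrime.mem_or_mem hw).elim h₁' h₂'

end Segre

/-! ### Coordinate rings of intersections of quadrics -/

section CoordinateRings

variable {R σ : Type} [CommRing R]

theorem adjoin_range_mk_X (I : HomogeneousIdeal (stdGrading R σ)) :
    Algebra.adjoin R (Set.range fun i => Ideal.Quotient.mk I.toIdeal (X i)) = ⊤ := by
  have h : Set.range (fun i => Ideal.Quotient.mk I.toIdeal (X i)) =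
      Ideal.Quotient.mkₐ R I.toIdeal '' Set.range (X : σ → MvPolynomial σ R) := by
    rw [← Set.range_comp]
    rfl
  rw [h, ← AlgHom.map_adjoin, adjoin_range_X, Algebra.map_top, AlgHom.range_eq_top]
  exact Ideal.Quotient.mkₐ_surjective R I.toIdeal

theorem mk_X_mem (I : HomogeneousIdeal (stdGrading R σ)) (i : σ) :
    Ideal.Quotient.mk I.toIdeal (X i) ∈ quotGrading I 1 :=
  mk_mem_quotGrading I (isHomogeneous_X R i)

variable {κ : Type} {F : κ → MvPolynomial σ R} (hF : ∀ i, (F i).IsHomogeneous 2)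

theorem exists_quadric_lift {T : Type} [CommRing T] (c : R →+* T) (t : σ → T)
    (h : ∀ i, eval₂Hom c t (F i) = 0) :
    ∃ f : MvPolynomial σ R ⧸ (quadricIdeal F hF).toIdeal →+* T,
      (∀ i, f (Ideal.Quotient.mk _ (X i)) = t i) ∧
        ∀ r, f (algebraMap R (MvPolynomial σ R ⧸ (quadricIdeal F hF).toIdeal) r) = c r := by
  have hle : ∀ a ∈ (quadricIdeal F hF).toIdeal, eval₂Hom c t a = 0 := by
    intro a ha
    refine (Ideal.span_le.2 ?_ : Ideal.span (Set.range F) ≤ RingHom.ker (eval₂Hom c t)) ha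
    rintro _ ⟨i, rfl⟩
    exact h i
  refine ⟨Ideal.Quotient.lift _ (eval₂Hom c t) hle, fun i => ?_, fun r => ?_⟩
  · rw [Ideal.Quotient.lift_mk, coe_eval₂Hom, eval₂_X]
  · change Ideal.Quotient.lift _ (eval₂Hom c t) hle (Ideal.Quotient.mk _ (C r)) = _
    rw [Ideal.Quotient.lift_mk, coe_eval₂Hom, eval₂_C]

theorem exists_quadric_liftₐ {T : Type} [CommRing T] [Algebra R T] (t : σ → T)
    (h : ∀ i, aeval t (F i) = 0) :
    ∃ f : MvPolynomial σ R ⧸ (quadricIdeal F hF).toIdeal →ₐ[R] T,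
      ∀ i, f (Ideal.Quotient.mk _ (X i)) = t i := by
  obtain ⟨f, h₁, h₂⟩ := exists_quadric_lift hF (algebraMap R T) t h
  exact ⟨{ f with commutes' := h₂ }, h₁⟩

theorem eval₂Hom_quadric {T : Type} [CommRing T]
    (f : MvPolynomial σ R ⧸ (quadricIdeal F hF).toIdeal →+* T) (i : κ) :
    eval₂Hom (f.comp (algebraMap R _)) (fun j => f (Ideal.Quotient.mk _ (X j))) (F i) = 0 := by
  have h : eval₂Hom (f.comp (algebraMap R _)) (fun j => f (Ideal.Quotient.mk _ (X j))) =
      f.comp (Ideal.Quotient.mk _) := by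
    apply MvPolynomial.ringHom_ext
    · intro r
      rw [coe_eval₂Hom, eval₂_C]
      rfl
    · intro j
      rw [coe_eval₂Hom, eval₂_X]
      rfl
  rw [h, RingHom.comp_apply, Ideal.Quotient.eq_zero_iff_mem.2, map_zero]
  exact Ideal.subset_span ⟨i, rfl⟩

end CoordinateRings

/-! ### Equivariance of the equations -/

section Equivariance

theorem matU_injective {T : Type} : Function.Injective (matU : (Fin 4 → T) → _) := by
  intro d e h
  have h' := fun i j => congrFun (congrFun h i) j
  have h0 := h' 0 0
  have h1 := h' 0 1
  have h2 := h' 1 0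
  have h3 := h' 1 1
  simp [matU] at h0 h1 h2 h3
  ext i
  fin_cases i <;> assumption

variable {T : Type} [CommRing T]

theorem eqS_eq_zero_iff (d u v : Fin 4 → T) :
    eqS d u v = 0 ↔ matU u * matV v = matV d * hat (matU u) ∧
      wedge2 (matV v) = Matrix.vecMul (wedge2 (matV d)) (hatDagger (matU u)).transpose := by
  rw [← sub_eq_zero (a := matU u * matV v), ← sub_eq_zero (a := wedge2 (matV v))]
  constructor
  · intro h
    refine ⟨?_, ?_⟩
    · ext i j
      exact congrFun h (Sum.inl (i, j))
    · ext j
      exact congrFun h (Sum.inr j)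
  · rintro ⟨h₁, h₂⟩
    ext (⟨i, j⟩ | j)
    · exact congrFun (congrFun h₁ i) j
    · exact congrFun h₂ j

theorem map_eqS {T' : Type} [CommRing T'] (φ : T →+* T') (d u v : Fin 4 → T)
    (i : (Fin 2 × Fin 3) ⊕ Fin 3) :
    φ (eqS d u v i) = eqS (fun j => φ (d j)) (fun j => φ (u j)) (fun j => φ (v j)) i := by
  rcases i with ⟨i, j⟩ | j
  · fin_cases i <;> fin_cases j <;>
      simp [eqS, matU, matV, hat, map_ofNat φ 2]
  · fin_cases j <;>
      simp [eqS, matU, matV, wedge2, hatDagger, Matrix.vecMul, dotProduct, Fin.sum_univ_succ,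
        map_ofNat φ 2]

theorem hat_mul (M N : Matrix (Fin 2) (Fin 2) T) : hat (M * N) = hat M * hat N := by
  ext i j
  fin_cases i <;> fin_cases j <;>
    simp [hat, Matrix.mul_apply, Fin.sum_univ_succ] <;> ring

theorem hatDagger_mul (M N : Matrix (Fin 2) (Fin 2) T) :
    hatDagger (M * N) = hatDagger N * hatDagger M := by
  ext i j
  fin_cases i <;> fin_cases j <;>
    simp [hatDagger, Matrix.mul_apply, Fin.sum_univ_succ] <;> ring

theorem hat_one : hat (1 : Matrix (Fin 2) (Fin 2) T) = 1 := by
  ext i j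
  fin_cases i <;> fin_cases j <;> simp [hat]

theorem hat_map {T' : Type} [CommRing T'] (φ : T →+* T') (M : Matrix (Fin 2) (Fin 2) T) :
    (hat M).map φ = hat (M.map φ) := by
  ext i j
  fin_cases i <;> fin_cases j <;> simp [hat, map_ofNat φ 2]

theorem matV_map {T' : Type} [CommRing T'] (φ : T →+* T') (d : Fin 4 → T) :
    (matV d).map φ = matV fun i => φ (d i) := by
  ext i j
  fin_cases i <;> fin_cases j <;> simp [matV]

theorem matV_smul (b : T) (d : Fin 4 → T) : matV (b • d) = b • matV d := by
  ext i j
  fin_cases i <;> fin_cases j <;> simp [matV]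

theorem matV_injective : Function.Injective (matV : (Fin 4 → T) → _) := by
  intro d e h
  have h' := fun i j => congrFun (congrFun h i) j
  have h0 := h' 0 0
  have h1 := h' 0 1
  have h2 := h' 0 2
  have h3 := h' 1 0
  simp [matV] at h0 h1 h2 h3
  ext i
  fin_cases i <;> assumption

theorem wedge2_smul (b : T) (M : Matrix (Fin 2) (Fin 3) T) :
    wedge2 (b • M) = b ^ 2 • wedge2 M := by
  ext j
  fin_cases j <;> simp [wedge2] <;> ring

theorem wedge2_mul_left (g : Matrix (Fin 2) (Fin 2) T) (M : Matrix (Fin 2) (Fin 3) T) :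
    wedge2 (g * M) = g.det • wedge2 M := by
  ext j
  fin_cases j <;> simp [wedge2, Matrix.mul_apply, Fin.sum_univ_succ, Matrix.det_fin_two] <;> ring

theorem wedge2_mul_hat (M : Matrix (Fin 2) (Fin 3) T) (g : Matrix (Fin 2) (Fin 2) T) :
    wedge2 (M * hat g) = g.det • Matrix.vecMul (wedge2 M) (hatDagger g).transpose := by
  ext j
  fin_cases j <;>
    simp [wedge2, hat, hatDagger, Matrix.vecMul, dotProduct, Matrix.mul_apply, Fin.sum_univ_succ,
      Matrix.det_fin_two] <;> ring

/-- The coordinates of `g U`. -/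
def moveU (g : Matrix (Fin 2) (Fin 2) T) (u : Fin 4 → T) : Fin 4 → T :=
  ![g 0 0 * u 0 + g 0 1 * u 2, g 0 0 * u 1 + g 0 1 * u 3,
    g 1 0 * u 0 + g 1 1 * u 2, g 1 0 * u 1 + g 1 1 * u 3]

theorem matU_moveU (g : Matrix (Fin 2) (Fin 2) T) (u : Fin 4 → T) :
    matU (moveU g u) = g * matU u := by
  ext i j
  fin_cases i <;> fin_cases j <;> simp [matU, moveU, Matrix.mul_apply]

theorem moveU_moveU (g h : Matrix (Fin 2) (Fin 2) T) (u : Fin 4 → T) :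
    moveU g (moveU h u) = moveU (g * h) u :=
  matU_injective (by simp only [matU_moveU, mul_assoc])

theorem moveU_one (u : Fin 4 → T) : moveU 1 u = u :=
  matU_injective (by rw [matU_moveU, one_mul])

/-- The relation `q = b • g p ĝ⁻¹` between two points of the affine space of the matrices `D`,
for `g` in `SL₂`. -/
structure Moves (g : Matrix (Fin 2) (Fin 2) T) (b : T) (p q : Fin 4 → T) : Prop where
  det : g.det = 1
  eq : matV q * hat g = b • (g * matV p)

theorem Moves.map {T' : Type} [CommRing T'] (φ : T →+* T') {g : Matrix (Fin 2) (Fin 2) T} {b : T}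
    {p q : Fin 4 → T} (h : Moves g b p q) :
    Moves (g.map φ) (φ b) (fun i => φ (p i)) fun i => φ (q i) where
  det := by
    have := congrArg φ h.det
    rwa [RingHom.map_det, map_one] at this
  eq := by
    have := congrArg (fun M : Matrix (Fin 2) (Fin 3) T => M.map φ) h.eq
    simp only [Matrix.map_mul] at this
    rw [matV_map, hat_map] at this
    rw [this, ← matV_map, ← Matrix.map_mul]
    ext i j
    simp only [Matrix.map_apply, Matrix.smul_apply, smul_eq_mul, map_mul]

theorem Moves.symm {g g' : Matrix (Fin 2) (Fin 2) T} {b b' : T} {p q : Fin 4 → T}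
    (h : Moves g b p q) (hg : g' * g = 1) (hb : b' * b = 1) : Moves g' b' q p where
  det := by
    have := congrArg Matrix.det hg
    rwa [Matrix.det_mul, h.det, mul_one, Matrix.det_one] at this
  eq := by
    have hg' : g * g' = 1 := mul_eq_one_comm.1 hg
    have h1 : b' • (g' * (matV q * hat g)) * hat g' = b' • (g' * matV q) := by
      rw [Matrix.smul_mul, Matrix.mul_assoc, Matrix.mul_assoc, ← hat_mul, hg', hat_one,
        Matrix.mul_one]
    rw [← h1, h.eq, Matrix.mul_smul, smul_smul, hb, one_smul, ← Matrix.mul_assoc, hg,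
      Matrix.one_mul]

/-- The equations of the variety are equivariant. -/
theorem Moves.eqS_eq_zero {g : Matrix (Fin 2) (Fin 2) T} {b : T} {p q u v : Fin 4 → T}
    (h : Moves g b p q) (huv : eqS p u v = 0) : eqS q (moveU g u) (b • v) = 0 := by
  rw [eqS_eq_zero_iff] at huv ⊢
  obtain ⟨h₁, h₂⟩ := huv
  rw [matU_moveU, matV_smul]
  refine ⟨?_, ?_⟩
  · rw [hat_mul, ← Matrix.mul_assoc, h.eq, Matrix.mul_smul, Matrix.mul_assoc, h₁,
      Matrix.smul_mul, Matrix.mul_assoc]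
  · have hw := congrArg wedge2 h.eq
    rw [wedge2_mul_hat, wedge2_smul, wedge2_mul_left, h.det, one_smul, one_smul] at hw
    rw [hatDagger_mul, Matrix.transpose_mul, ← Matrix.vecMul_vecMul, hw, wedge2_smul, h₂,
      Matrix.smul_vecMul]

end Equivariance

/-! ### The fibres -/

section Fibers

theorem eval₂Hom_eqS {R T : Type} [CommRing R] [CommRing T] (c : R →+* T) (t : FIdx → T)
    (d : Fin 4 → R) (i : (Fin 2 × Fin 3) ⊕ Fin 3) :
    eval₂Hom c t (eqS (fun j => C (d j)) (uVar R) (vVar R) i) =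
      eqS (fun j => c (d j)) (fun j => t (Sum.inl j)) (fun j => t (Sum.inr j)) i := by
  rw [map_eqS]
  simp only [coe_eval₂Hom, eval₂_C, uVar, vVar, eval₂_X]

/-- The ideal `I` is generated by the equations `eqS d u v`, expressed by the universal property
of its residue class ring. -/
structure RepresentsEqS {R : Type} [CommRing R] (d : Fin 4 → R)
    (I : HomogeneousIdeal (stdGrading R FIdx)) : Prop where
  rel : ∀ {T : Type} [CommRing T] (a : MvPolynomial FIdx R ⧸ I.toIdeal →+* T),
    eqS (fun j => a (algebraMap R _ (d j))) (fun j => a (Ideal.Quotient.mk _ (X (Sum.inl j))))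
      (fun j => a (Ideal.Quotient.mk _ (X (Sum.inr j)))) = 0
  lift : ∀ {T : Type} [CommRing T] (c : R →+* T) (t : FIdx → T),
    eqS (fun j => c (d j)) (fun j => t (Sum.inl j)) (fun j => t (Sum.inr j)) = 0 →
      ∃ f : MvPolynomial FIdx R ⧸ I.toIdeal →+* T,
        (∀ i, f (Ideal.Quotient.mk _ (X i)) = t i) ∧
          ∀ r, f (algebraMap R (MvPolynomial FIdx R ⧸ I.toIdeal) r) = c r

theorem representsEqS_quadricIdeal {R κ : Type} [CommRing R] {d : Fin 4 → R}
    {F : κ → MvPolynomial FIdx R} (hF : ∀ i, (F i).IsHomogeneous 2)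
    (H : ∀ (T : Type) [CommRing T] (c : R →+* T) (t : FIdx → T),
      (∀ i, eval₂Hom c t (F i) = 0) ↔
        eqS (fun j => c (d j)) (fun j => t (Sum.inl j)) (fun j => t (Sum.inr j)) = 0) :
    RepresentsEqS d (quadricIdeal F hF) where
  rel a := by
    have h := (H _ _ _).1 (eval₂Hom_quadric hF a)
    simp only [RingHom.comp_apply] at h
    exact h
  lift c t h := exists_quadric_lift hF c t ((H _ c t).2 h)

theorem representsEqS_idealS : RepresentsEqS X idealS :=
  representsEqS_quadricIdeal _ fun _ _ c t => by
    rw [funext_iff]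
    exact forall_congr' fun i => by
      rw [← eval₂Hom_eqS]
      rfl

/-- The images of the homogeneous coordinates under the action of `(g, b)`. -/
def moveCoord {T : Type} [CommRing T] (g : Matrix (Fin 2) (Fin 2) T) (b : T) (t : FIdx → T) :
    FIdx → T :=
  Sum.elim (moveU g fun j => t (Sum.inl j)) (b • fun j => t (Sum.inr j))

theorem moveCoord_moveCoord {T : Type} [CommRing T] {g g' : Matrix (Fin 2) (Fin 2) T} {b b' : T}
    (hg : g' * g = 1) (hb : b' * b = 1) (t : FIdx → T) :
    moveCoord g' b' (moveCoord g b t) = t := by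
  ext (i | i)
  · change moveU g' (moveU g fun j => t (Sum.inl j)) i = _
    rw [moveU_moveU, hg, moveU_one]
  · change b' * (b * t (Sum.inr i)) = _
    rw [← mul_assoc, hb, one_mul]

theorem map_moveCoord {T T' : Type} [CommRing T] [CommRing T'] (φ : T →+* T')
    (g : Matrix (Fin 2) (Fin 2) T) (b : T) (t : FIdx → T) (i : FIdx) :
    φ (moveCoord g b t i) = moveCoord (g.map φ) (φ b) (fun j => φ (t j)) i := by
  rcases i with i | i
  · fin_cases i <;> simp [moveCoord, moveU]
  · simp [moveCoord]

theorem moveCoord_mem {T S : Type} [CommRing T] [CommRing S] [Algebra T S] (M : Submodule T S)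
    {t : FIdx → S} (ht : ∀ i, t i ∈ M) (g : Matrix (Fin 2) (Fin 2) T) (b : T) (i : FIdx) :
    moveCoord (g.map (algebraMap T S)) (algebraMap T S b) t i ∈ M := by
  rcases i with i | i
  · fin_cases i <;> simp [moveCoord, moveU, ← Algebra.smul_def] <;>
      exact add_mem (M.smul_mem _ (ht _)) (M.smul_mem _ (ht _))
  · change algebraMap T S b * t (Sum.inr i) ∈ M
    rw [← Algebra.smul_def]
    exact M.smul_mem _ (ht _)

theorem map_mul_map_eq_one {T : Type} [CommRing T] (c : ℂ →+* T)
    {m n : Matrix (Fin 2) (Fin 2) ℂ} (h : m * n = 1) : m.map c * n.map c = 1 := by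
  rw [← Matrix.map_mul, h]
  exact Matrix.map_one _ (map_zero c) (map_one c)

theorem exists_gradedRingHom {I : HomogeneousIdeal (stdGrading RD FIdx)}
    (hI : RepresentsEqS X I) {J : HomogeneousIdeal (stdGrading ℂ FIdx)} {p q : Fin 4 → ℂ}
    (hJ : RepresentsEqS p J) {g : Matrix (Fin 2) (Fin 2) ℂ} {b : ℂ} (h : Moves g b p q) :
    ∃ φ : GradedRingHom (quotGrading I) (quotGrading J),
      (∀ r, φ (algebraMap RD _ r) = algebraMap ℂ _ (eval q r)) ∧
      ∀ i, φ (Ideal.Quotient.mk _ (X i)) =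
        moveCoord (g.map (algebraMap ℂ _)) (algebraMap ℂ _ b)
          (fun j => Ideal.Quotient.mk _ (X j)) i := by
  have hrel := hJ.rel (RingHom.id _)
  simp only [RingHom.id_apply] at hrel
  have hmove := (h.map (algebraMap ℂ (MvPolynomial FIdx ℂ ⧸ J.toIdeal))).eqS_eq_zero hrel
  obtain ⟨f, hf₁, hf₂⟩ := hI.lift ((algebraMap ℂ (MvPolynomial FIdx ℂ ⧸ J.toIdeal)).comp (eval q))
    (moveCoord (g.map (algebraMap ℂ _)) (algebraMap ℂ _ b) fun j => Ideal.Quotient.mk _ (X j)) (by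
      simp only [RingHom.comp_apply, eval_X]
      exact hmove)
  exact ⟨gradedHomOfGenerators (quotGrading I) (adjoin_range_mk_X I) (mk_X_mem I) f
      (fun r => by
        rw [hf₂]
        exact SetLike.algebraMap_mem_graded _ _)
      (fun i => by
        rw [hf₁]
        exact moveCoord_mem _ (mk_X_mem _) g b i), hf₂, hf₁⟩

theorem adjoin_range_moveCoord (J : HomogeneousIdeal (stdGrading ℂ FIdx))
    {g g' : Matrix (Fin 2) (Fin 2) ℂ} {b b' : ℂ} (hg : g' * g = 1) (hb : b' * b = 1) :
    Algebra.adjoin ℂ (Set.range (moveCoord (g.map (algebraMap ℂ _)) (algebraMap ℂ _ b)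
          (fun j => Ideal.Quotient.mk J.toIdeal (X j)))) = ⊤ := by
  rw [← top_le_iff, ← adjoin_range_mk_X J, Algebra.adjoin_le_iff]
  rintro _ ⟨i, rfl⟩
  have hb' : algebraMap ℂ (MvPolynomial FIdx ℂ ⧸ J.toIdeal) b' * algebraMap ℂ _ b = 1 := by
    rw [← map_mul, hb, map_one]
  have h₁ := congrFun (moveCoord_moveCoord (map_mul_map_eq_one
    (algebraMap ℂ (MvPolynomial FIdx ℂ ⧸ J.toIdeal)) hg) hb'
    (fun j => Ideal.Quotient.mk J.toIdeal (X j))) i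
  refine Eq.mpr (congrArg (· ∈ _) h₁.symm) ?_
  exact moveCoord_mem (Subalgebra.toSubmodule (Algebra.adjoin ℂ
    (Set.range (moveCoord (g.map (algebraMap ℂ (MvPolynomial FIdx ℂ ⧸ J.toIdeal)))
      (algebraMap ℂ _ b) (fun j => Ideal.Quotient.mk J.toIdeal (X j))))))
    (fun j => Algebra.subset_adjoin (Set.mem_range_self j)) g' b' i

/-- The fibre over a point `q` in the orbit of `p`, as a closed subscheme of projective space. -/
theorem exists_isPullback_projToSpec {I : HomogeneousIdeal (stdGrading RD FIdx)}
    (hI : RepresentsEqS X I) {J : HomogeneousIdeal (stdGrading ℂ FIdx)} {p q : Fin 4 → ℂ}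
    (hJ : RepresentsEqS p J) {g : Matrix (Fin 2) (Fin 2) ℂ} {b : ℂ}
    (h : Moves g b p q) (hb : b ≠ 0) :
    ∃ (φ : GradedRingHom (quotGrading I) (quotGrading J))
      (hφ : HomogeneousIdeal.irrelevant (quotGrading J) ≤
        (HomogeneousIdeal.irrelevant (quotGrading I)).map φ),
      (∀ r, φ (algebraMap RD _ r) = algebraMap ℂ _ (eval q r)) ∧
      (∀ i, φ (Ideal.Quotient.mk _ (X i)) =
        moveCoord (g.map (algebraMap ℂ _)) (algebraMap ℂ _ b)
          (fun j => Ideal.Quotient.mk _ (X j)) i) ∧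
      IsPullback (Proj.map φ hφ) (projToSpec (quotGrading J)) (projToSpec (quotGrading I))
        (pointD q) := by
  obtain ⟨φ, hφ₂, hφ₁⟩ := exists_gradedRingHom hI hJ h
  have hdet : IsUnit g.det := by rw [h.det]; exact isUnit_one
  have hinv : g⁻¹ * g = 1 := Matrix.nonsing_inv_mul g hdet
  have hinv' : g * g⁻¹ = 1 := Matrix.mul_nonsing_inv g hdet
  have hbb : b⁻¹ * b = 1 := inv_mul_cancel₀ hb
  have hgen : Algebra.adjoin ℂ (Set.range fun i => φ (Ideal.Quotient.mk _ (X i))) = ⊤ := by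
    rw [← adjoin_range_moveCoord J hinv hbb]
    exact congrArg (fun t => Algebra.adjoin ℂ (Set.range t)) (funext hφ₁)
  have hsymm : Moves g⁻¹ b⁻¹ q p := h.symm hinv hbb
  refine ⟨φ, irrelevant_le_map_of_generators φ (mk_X_mem I) hgen, hφ₂, hφ₁,
    isPullback_proj_map (eval q) φ hφ₂ (adjoin_range_mk_X I) (mk_X_mem I) hgen ?_⟩
  intro T _ a c hac
  have hT : eqS (fun j => c (q j)) (fun j => a (Ideal.Quotient.mk _ (X (Sum.inl j))))
      (fun j => a (Ideal.Quotient.mk _ (X (Sum.inr j)))) = 0 := by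
    rw [← hI.rel a]
    simp only [hac, eval_X]
  have hmove := (hsymm.map c).eqS_eq_zero hT
  obtain ⟨k, hk₁, hk₂⟩ := hJ.lift c
    (moveCoord (g⁻¹.map c) (c b⁻¹) fun j => a (Ideal.Quotient.mk _ (X j))) hmove
  refine ⟨k, fun i => ?_, hk₂⟩
  have hgk : (g.map (algebraMap ℂ (MvPolynomial FIdx ℂ ⧸ J.toIdeal))).map k = g.map c := by
    ext i j
    exact hk₂ _
  have hcb : c b * c b⁻¹ = 1 := by
    rw [← map_mul, mul_inv_cancel₀ hb, map_one]
  rw [hφ₁, map_moveCoord, hk₂, hgk]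
  simp only [hk₁]
  exact congrFun (moveCoord_moveCoord (map_mul_map_eq_one c hinv') hcb _) i

/-- The fibre over a point `q` in the orbit of `p`. -/
theorem nonempty_fiber_iso {J : HomogeneousIdeal (stdGrading ℂ FIdx)} {p q : Fin 4 → ℂ}
    (hJ : RepresentsEqS p J) {g : Matrix (Fin 2) (Fin 2) ℂ} {b : ℂ}
    (h : Moves g b p q) (hb : b ≠ 0) :
    Nonempty (fiber q ≅ Over.mk (projZerosToSpec J)) := by
  obtain ⟨φ, hφ, -, -, hp⟩ := exists_isPullback_projToSpec representsEqS_idealS hJ h hb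
  have hp' : IsPullback (Proj.map φ hφ) (projZerosToSpec J) rho (pointD q) := hp
  exact ⟨(Over.isoMk hp'.isoPullback hp'.isoPullback_hom_snd).symm⟩

theorem representsEqS_idealS0 : RepresentsEqS 0 idealS0 :=
  representsEqS_quadricIdeal _ fun _ _ c t => by
    rw [funext_iff]
    have h : eqS0 (uVar ℂ) (vVar ℂ) = eqS (fun j => C ((0 : Fin 4 → ℂ) j)) (uVar ℂ) (vVar ℂ) := by
      ext1 (⟨i, j⟩ | j)
      · fin_cases i <;> fin_cases j <;> simp [eqS, eqS0, matV, Matrix.vecMul, dotProduct,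
          Fin.sum_univ_succ]
      · fin_cases j <;> simp [eqS, eqS0, matV, wedge2, Matrix.vecMul, dotProduct,
          Fin.sum_univ_succ]
    exact forall_congr' fun i => by
      rw [h, eval₂Hom_eqS]
      rfl

theorem nonempty_fiberInProj_zero_iso : Nonempty (fiberInProj 0 ≅ zeroFiberInProj) := by
  have hm : Moves (1 : Matrix (Fin 2) (Fin 2) ℂ) 1 0 0 := ⟨by simp, by
    rw [hat_one]
    simp⟩
  obtain ⟨φ, hφ, hφ₁, hφ₂, hp⟩ := exists_isPullback_projToSpec representsEqS_idealS
    representsEqS_idealS0 hm one_ne_zero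
  have hp' : IsPullback (X := projZeros idealS) (P := projZeros idealS0)
      (Proj.map φ hφ) (projZerosToSpec idealS0) rho (pointD 0) := hp
  have hc : φ.comp (coordHom ℂ idealS) = coordHom ℂ idealS0 := by
    refine DFunLike.ext _ _ fun f => ?_
    change ((φ : MvPolynomial FIdx RD ⧸ idealS.toIdeal →+*
      MvPolynomial FIdx ℂ ⧸ idealS0.toIdeal).comp
      (coordHom ℂ idealS).toRingHom) f = (coordHom ℂ idealS0).toRingHom f
    congr 1
    apply MvPolynomial.ringHom_ext
    · intro r
      refine (congrArg φ (congrArg (Ideal.Quotient.mk _) (map_C _ r))).trans ?_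
      refine (hφ₁ (algebraMap ℂ RD r)).trans ?_
      refine Eq.trans ?_ (congrArg (Ideal.Quotient.mk _) (map_C _ r)).symm
      refine congrArg (algebraMap ℂ (MvPolynomial FIdx ℂ ⧸ idealS0.toIdeal)) ?_
      exact eval_C r
    · intro i
      refine (congrArg φ (congrArg (Ideal.Quotient.mk _) (map_X _ i))).trans ?_
      refine (hφ₂ i).trans ?_
      refine Eq.trans ?_ (congrArg (Ideal.Quotient.mk _) (map_X _ i)).symm
      rcases i with i | i
      · fin_cases i <;> simp [moveCoord, moveU]
      · simp [moveCoord]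
  refine ⟨(Over.isoMk hp'.isoPullback ?_).symm⟩
  refine (hp'.isoPullback_hom_fst_assoc _).trans ?_
  refine (Proj.map_comp _ _ _ _).symm.trans ?_
  simp only [hc]
  rfl

end Fibers

/-! ### The equations in coordinates, and the fibre `ℙ^{1,1,1}` -/

section ConeFiber

theorem eqS_eq_zero_iff_coord {T : Type} [CommRing T] (d u v : Fin 4 → T) :
    eqS d u v = 0 ↔
      (u 0 * v 2 - u 1 * v 3 = d 2 * u 0 ^ 2 + 2 * d 1 * u 0 * u 2 + d 0 * u 2 ^ 2 ∧
      u 0 * v 1 - u 1 * v 2 =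
        d 2 * u 0 * u 1 + d 1 * (u 0 * u 3 + u 1 * u 2) + d 0 * u 2 * u 3 ∧
      u 0 * v 0 - u 1 * v 1 = d 2 * u 1 ^ 2 + 2 * d 1 * u 1 * u 3 + d 0 * u 3 ^ 2) ∧
      (u 2 * v 2 - u 3 * v 3 = -(d 3 * u 0 ^ 2 + 2 * d 2 * u 0 * u 2 + d 1 * u 2 ^ 2) ∧
      u 2 * v 1 - u 3 * v 2 =
        -(d 3 * u 0 * u 1 + d 2 * (u 0 * u 3 + u 1 * u 2) + d 1 * u 2 * u 3) ∧
      u 2 * v 0 - u 3 * v 1 = -(d 3 * u 1 ^ 2 + 2 * d 2 * u 1 * u 3 + d 1 * u 3 ^ 2)) ∧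
      v 0 * v 2 - v 1 ^ 2 = (d 0 * d 2 - d 1 ^ 2) * u 3 ^ 2 -
        (d 1 * d 2 - d 0 * d 3) * u 1 * u 3 + (d 1 * d 3 - d 2 ^ 2) * u 1 ^ 2 ∧
      v 1 * v 2 - v 0 * v 3 = -2 * (d 0 * d 2 - d 1 ^ 2) * u 2 * u 3 +
        (d 1 * d 2 - d 0 * d 3) * (u 0 * u 3 + u 1 * u 2) -
          2 * (d 1 * d 3 - d 2 ^ 2) * u 0 * u 1 ∧
      v 1 * v 3 - v 2 ^ 2 = (d 0 * d 2 - d 1 ^ 2) * u 2 ^ 2 -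
        (d 1 * d 2 - d 0 * d 3) * u 0 * u 2 + (d 1 * d 3 - d 2 ^ 2) * u 0 ^ 2 := by
  rw [funext_iff, Sum.forall, Prod.forall, Fin.forall_fin_succ, Fin.forall_fin_one]
  simp only [Fin.forall_fin_succ, IsEmpty.forall_iff, and_true, and_assoc, eqS, Sum.elim_inl,
    Sum.elim_inr, Pi.zero_apply]
  simp [matU, matV, hat, hatDagger, wedge2, Matrix.vecMul, dotProduct,
    Fin.sum_univ_succ]
  simp only [← and_assoc]
  repeat' apply and_congr
  all_goals
    refine Iff.trans (iff_of_eq (congrArg (· = 0) ?_)) sub_eq_zero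
    ring

/-- The point of the cone over the twisted cubic whose fibre is `ℙ^{1,1,1}`. -/
theorem representsEqS_idealP111 : RepresentsEqS ![1, 0, 0, 0] idealP111 :=
  representsEqS_quadricIdeal _ fun T _ c t => by
    have h (i) : eval₂Hom c t (eqP111 (uVar ℂ) (vVar ℂ) i) =
        eqP111 (fun j => t (Sum.inl j)) (fun j => t (Sum.inr j)) i := by
      rcases i with ⟨i, j⟩ | j
      · fin_cases i <;> fin_cases j <;> simp [eqP111, matN, Matrix.det_fin_two, uVar, vVar]
      · fin_cases j <;> simp [eqP111, uVar, vVar]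
    simp only [h]
    generalize (fun j => t (Sum.inl j)) = u
    generalize (fun j => t (Sum.inr j)) = v
    rw [eqS_eq_zero_iff_coord]
    simp only [Matrix.cons_val, map_zero, map_one]
    constructor
    · intro H
      have a0 := H (Sum.inr 0)
      have a1 := H (Sum.inr 1)
      have a2 := H (Sum.inr 2)
      have m01 := H (Sum.inl (0, 1))
      have m02 := H (Sum.inl (0, 2))
      have m03 := H (Sum.inl (0, 3))
      have m12 := H (Sum.inl (1, 2))
      have m13 := H (Sum.inl (1, 3))
      have m23 := H (Sum.inl (2, 3))
      simp [eqP111, matN, Matrix.det_fin_two] at a0 a1 a2 m01 m02 m03 m12 m13 m23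
      refine ⟨⟨?_, ?_, ?_⟩, ⟨?_, ?_, ?_⟩, ?_, ?_, ?_⟩
      · linear_combination a0
      · linear_combination a1
      · linear_combination a2
      · linear_combination m01
      · linear_combination m02
      · linear_combination m03
      · linear_combination m23
      · linear_combination -m13
      · linear_combination m12
    · rintro ⟨⟨h0, h1, h2⟩, ⟨h3, h4, h5⟩, h6, h7, h8⟩ (⟨i, j⟩ | j)
      · fin_cases i <;> fin_cases j <;> simp [eqP111, matN, Matrix.det_fin_two]
        all_goals grind
      · fin_cases j
        · change u 0 * v 2 - u 1 * v 3 - u 2 ^ 2 = 0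
          linear_combination h0
        · change u 0 * v 1 - u 1 * v 2 - u 2 * u 3 = 0
          linear_combination h1
        · change u 0 * v 0 - u 1 * v 1 - u 3 ^ 2 = 0
          linear_combination h2
end ConeFiber

/-! ### The fibres that are products -/

section ProductFibers

theorem nonempty_iso_prodC {P X Y : Scheme.{0}} {p : P ⟶ X} {q : P ⟶ Y} {s : P ⟶ SpecC}
    {f : X ⟶ SpecC} {g : Y ⟶ SpecC} (h : IsPullback p q f g) (hs : p ≫ f = s) :
    Nonempty (Over.mk s ≅ prodC (Over.mk f) (Over.mk g)) :=
  ⟨Over.isoMk h.isoPullback (by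
    change h.isoPullback.hom ≫ Limits.pullback.fst f g ≫ f = s
    rw [h.isoPullback_hom_fst_assoc, hs])⟩

theorem exists_pullback_iso_left {X X' Y : Scheme.{0}} {f : X ⟶ SpecC} {f' : X' ⟶ SpecC}
    (g : Y ⟶ SpecC) (e : X ⟶ X') [IsIso e] (h : e ≫ f' = f) :
    ∃ i : Limits.pullback f g ≅ Limits.pullback f' g,
      i.hom ≫ Limits.pullback.fst f' g = Limits.pullback.fst f g ≫ e :=
  ⟨asIso (Limits.pullback.map f g f' g e (𝟙 Y) (𝟙 SpecC) (by simp [h]) (by simp)),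
    Limits.pullback.lift_fst _ _ _⟩

theorem nonempty_prodC_iso_left {X X' : Over SpecC} (e : X ≅ X') (Y : Over SpecC) :
    Nonempty (prodC X Y ≅ prodC X' Y) := by
  have : IsIso e.hom.left := ((Over.forget _).mapIso e).isIso_hom
  have h : e.hom.left ≫ X'.hom = X.hom := Over.w e.hom
  obtain ⟨i, hi⟩ := exists_pullback_iso_left Y.hom e.hom.left h
  refine ⟨Over.isoMk i ?_⟩
  change i.hom ≫ Limits.pullback.fst X'.hom Y.hom ≫ X'.hom = Limits.pullback.fst X.hom Y.hom ≫ X.hom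
  rw [reassoc_of% hi, h]

/-- The homogeneous ideal generated by the equations `eqS p u v`. -/
def fiberIdeal (p : Fin 4 → ℂ) : HomogeneousIdeal (stdGrading ℂ FIdx) :=
  quadricIdeal (eqS (fun j => C (p j)) (uVar ℂ) (vVar ℂ))
    (eqS_isHomogeneous (fun _ => isHomogeneous_C _ _) (uVar_isHomogeneous _) (vVar_isHomogeneous _))

theorem representsEqS_fiberIdeal (p : Fin 4 → ℂ) : RepresentsEqS p (fiberIdeal p) :=
  representsEqS_quadricIdeal _ fun _ _ c t => by
    rw [funext_iff]
    exact forall_congr' fun i => by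
      rw [eval₂Hom_eqS]
      rfl

theorem segre_minors {S κ : Type} [CommRing S] {z : Fin 2 → κ → S}
    (h : ∀ j j', z 0 j * z 1 j' = z 0 j' * z 1 j) (i : Fin 2) (j : κ) (i' : Fin 2) (j' : κ) :
    z i j * z i' j' = z i j' * z i' j := by
  fin_cases i <;> fin_cases i'
  · exact mul_comm _ _
  · exact h _ _
  · exact (mul_comm _ _).trans ((h j' j).trans (mul_comm _ _))
  · exact mul_comm _ _

theorem adjoin_eq_top_of_mk_X_mem {J : HomogeneousIdeal (stdGrading ℂ FIdx)}
    {s : Set (MvPolynomial FIdx ℂ ⧸ J.toIdeal)}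
    (hu : ∀ i, Ideal.Quotient.mk J.toIdeal (X (Sum.inl i)) ∈ Algebra.adjoin ℂ s)
    (hv : ∀ i, Ideal.Quotient.mk J.toIdeal (X (Sum.inr i)) ∈ Algebra.adjoin ℂ s) :
    Algebra.adjoin ℂ s = ⊤ := by
  rw [← top_le_iff, ← adjoin_range_mk_X J, Algebra.adjoin_le_iff]
  rintro _ ⟨i | i, rfl⟩
  · exact hu i
  · exact hv i

theorem algebraMap_third (S : Type) [CommRing S] [Algebra ℂ S] :
    3 * algebraMap ℂ S (1 / 3) = 1 := by
  rw [← map_ofNat (algebraMap ℂ S) 3, ← map_mul]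
  norm_num

/-- The coordinates of `ℙ⁷` on the image of the Segre embedding of `ℙ¹ × Q`. -/
theorem eqS_segre_conic {T : Type} [CommRing T] (e : T) (n : Fin 2 → T) {q : Fin 4 → T}
    (hq : q 3 ^ 2 = q 1 * q 2) :
    eqS ![0, 1, 0, 0]
      ![e * (3 * (n 0 * q 0)), e * (3 * (n 1 * q 0)), e * (n 0 * q 3 - n 1 * q 1),
        e * (n 0 * q 2 - n 1 * q 3)]
      ![e * (3 * (n 1 * q 2)), e * (n 0 * q 2 + 2 * (n 1 * q 3)),
        e * (2 * (n 0 * q 3) + n 1 * q 1), e * (3 * (n 0 * q 1))] = 0 := by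
  rw [eqS_eq_zero_iff_coord]
  simp only [Matrix.cons_val]
  refine ⟨⟨?_, ?_, ?_⟩, ⟨?_, ?_, ?_⟩, ?_, ?_, ?_⟩
  · ring
  · ring
  · ring
  · linear_combination 3 * e ^ 2 * n 0 ^ 2 * hq
  · linear_combination 3 * e ^ 2 * n 0 * n 1 * hq
  · linear_combination 3 * e ^ 2 * n 1 ^ 2 * hq
  · linear_combination -3 * e ^ 2 * n 1 ^ 2 * hq
  · linear_combination 6 * e ^ 2 * n 0 * n 1 * hq
  · linear_combination -3 * e ^ 2 * n 0 ^ 2 * hq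

theorem nonempty_iso_prodC_P1_Q {J : HomogeneousIdeal (stdGrading ℂ FIdx)}
    (hJ : RepresentsEqS ![0, 1, 0, 0] J) :
    Nonempty (Over.mk (projZerosToSpec J) ≅ prodC P1 Q) := by
  have hrel := hJ.rel (RingHom.id _)
  rw [eqS_eq_zero_iff_coord] at hrel
  have hmem := mk_X_mem J
  have hgen := @adjoin_eq_top_of_mk_X_mem J
  have hlift := @hJ.lift
  simp only [RingHom.id_apply] at hrel
  have he := algebraMap_third (MvPolynomial FIdx ℂ ⧸ J.toIdeal)
  set u : Fin 4 → MvPolynomial FIdx ℂ ⧸ J.toIdeal :=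
    fun j => Ideal.Quotient.mk J.toIdeal (X (Sum.inl j)) with hu
  set v : Fin 4 → MvPolynomial FIdx ℂ ⧸ J.toIdeal :=
    fun j => Ideal.Quotient.mk J.toIdeal (X (Sum.inr j)) with hv
  have hu1 (i) : u i ∈ quotGrading J 1 := hmem _
  have hv1 (i) : v i ∈ quotGrading J 1 := hmem _
  simp only [Matrix.cons_val, map_zero, map_one] at hrel
  obtain ⟨⟨h0, h1, h2⟩, ⟨h3, h4, h5⟩, h6, h7, h8⟩ := hrel
  let z : Fin 2 → Fin 4 → MvPolynomial FIdx ℂ ⧸ J.toIdeal :=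
    ![![u 0, v 3, v 1 + 2 * u 3, u 2 + v 2], ![u 1, v 2 - 2 * u 2, v 0, v 1 - u 3]]
  have hz1 (i j) : z i j ∈ quotGrading J 1 := by
    have h2u (i) : 2 * u i ∈ quotGrading J 1 := by
      rw [two_mul]
      exact add_mem (hu1 i) (hu1 i)
    fin_cases i <;> fin_cases j
    · exact hu1 0
    · exact hv1 3
    · exact add_mem (hv1 1) (h2u 3)
    · exact add_mem (hu1 2) (hv1 2)
    · exact hu1 1
    · exact sub_mem (hv1 2) (h2u 2)
    · exact hv1 0
    · exact sub_mem (hv1 1) (hu1 3)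
  have hminor : ∀ j j', z 0 j * z 1 j' = z 0 j' * z 1 j := by
    have m01 : z 0 0 * z 1 1 = z 0 1 * z 1 0 := by
      change u 0 * (v 2 - 2 * u 2) = v 3 * u 1
      linear_combination h0
    have m02 : z 0 0 * z 1 2 = z 0 2 * z 1 0 := by
      change u 0 * v 0 = (v 1 + 2 * u 3) * u 1
      linear_combination h2
    have m03 : z 0 0 * z 1 3 = z 0 3 * z 1 0 := by
      change u 0 * (v 1 - u 3) = (u 2 + v 2) * u 1
      linear_combination h1
    have m12 : z 0 1 * z 1 2 = z 0 2 * z 1 1 := by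
      change v 3 * v 0 = (v 1 + 2 * u 3) * (v 2 - 2 * u 2)
      linear_combination 2 * h4 - h7
    have m13 : z 0 1 * z 1 3 = z 0 3 * z 1 1 := by
      change v 3 * (v 1 - u 3) = (u 2 + v 2) * (v 2 - 2 * u 2)
      linear_combination h3 + h8
    have m23 : z 0 2 * z 1 3 = z 0 3 * z 1 2 := by
      change (v 1 + 2 * u 3) * (v 1 - u 3) = (u 2 + v 2) * v 0
      linear_combination - h5 - h6
    intro j j'
    fin_cases j <;> fin_cases j' <;>
      first
        | rfl | exact m01 | exact m02 | exact m03 | exact m12 | exact m13 | exact m23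
        | exact m01.symm | exact m02.symm | exact m03.symm | exact m12.symm | exact m13.symm
        | exact m23.symm
  have hquad (i) : z i 3 ^ 2 = z i 1 * z i 2 := by
    fin_cases i
    · change (u 2 + v 2) ^ 2 = v 3 * (v 1 + 2 * u 3)
      linear_combination 2 * h3 - h8
    · change (v 1 - u 3) ^ 2 = (v 2 - 2 * u 2) * v 0
      linear_combination 2 * h5 - h6
  have hz : Algebra.adjoin ℂ (Set.range fun ij : Fin 2 × Fin 4 => z ij.1 ij.2) = ⊤ := by
    have hmz (i j) : z i j ∈ Algebra.adjoin ℂ (Set.range fun ij : Fin 2 × Fin 4 => z ij.1 ij.2) :=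
      Algebra.subset_adjoin ⟨(i, j), rfl⟩
    have hme := Subalgebra.algebraMap_mem
      (Algebra.adjoin ℂ (Set.range fun ij : Fin 2 × Fin 4 => z ij.1 ij.2)) (1 / 3)
    refine hgen (fun i => ?_) fun i => ?_
    · change u i ∈ _
      fin_cases i
      · exact hmz 0 0
      · exact hmz 1 0
      · have h : u 2 = algebraMap ℂ _ (1 / 3) * (z 0 3 - z 1 1) := by
          change u 2 = algebraMap ℂ _ (1 / 3) * (u 2 + v 2 - (v 2 - 2 * u 2))
          linear_combination -u 2 * he
        exact Eq.mpr (congrArg (· ∈ _) h) (mul_mem hme (sub_mem (hmz 0 3) (hmz 1 1)))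
      · have h : u 3 = algebraMap ℂ _ (1 / 3) * (z 0 2 - z 1 3) := by
          change u 3 = algebraMap ℂ _ (1 / 3) * (v 1 + 2 * u 3 - (v 1 - u 3))
          linear_combination -u 3 * he
        exact Eq.mpr (congrArg (· ∈ _) h) (mul_mem hme (sub_mem (hmz 0 2) (hmz 1 3)))
    · change v i ∈ _
      fin_cases i
      · exact hmz 1 2
      · have h : v 1 = algebraMap ℂ _ (1 / 3) * (z 0 2 + (z 1 3 + z 1 3)) := by
          change v 1 = algebraMap ℂ _ (1 / 3) * (v 1 + 2 * u 3 + (v 1 - u 3 + (v 1 - u 3)))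
          linear_combination -v 1 * he
        exact Eq.mpr (congrArg (· ∈ _) h)
          (mul_mem hme (add_mem (hmz 0 2) (add_mem (hmz 1 3) (hmz 1 3))))
      · have h : v 2 = algebraMap ℂ _ (1 / 3) * (z 0 3 + z 0 3 + z 1 1) := by
          change v 2 = algebraMap ℂ _ (1 / 3) * (u 2 + v 2 + (u 2 + v 2) + (v 2 - 2 * u 2))
          linear_combination -v 2 * he
        exact Eq.mpr (congrArg (· ∈ _) h)
          (mul_mem hme (add_mem (add_mem (hmz 0 3) (hmz 0 3)) (hmz 1 1)))
      · exact hmz 0 1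
  have hβ (i : Fin 2) : ∃ f : MvPolynomial (Fin 4) ℂ ⧸ idealQ.toIdeal →ₐ[ℂ]
      MvPolynomial FIdx ℂ ⧸ J.toIdeal, ∀ j, f (Ideal.Quotient.mk _ (X j)) = z i j :=
    exists_quadric_liftₐ _ _ fun _ => by simp [hquad]
  choose β hβ using hβ
  obtain ⟨p, q, hp, hpq⟩ := exists_isPullback_segre (𝒜 := stdGrading ℂ (Fin 2))
    (ℬ := quotGrading idealQ) (𝒮 := quotGrading J)
    (x := X) (y := fun i => Ideal.Quotient.mk _ (X i)) adjoin_range_X (isHomogeneous_X ℂ)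
    (adjoin_range_mk_X idealQ) (mk_X_mem idealQ) hz1 hz
    (fun j => aeval fun i => z i j) (fun i j => by simp) β hβ (segre_minors hminor) (by
      intro T _ a b hab
      have hq := eval₂Hom_quadric (F := fun _ : Unit => X 3 ^ 2 - X 1 * X 2) _ b ()
      simp only [map_sub, map_pow, map_mul, coe_eval₂Hom, eval₂_X, sub_eq_zero] at hq
      obtain ⟨e, he⟩ : ∃ e : T, 3 * e = 1 := by
        refine ⟨a (C (1 / 3)), ?_⟩
        rw [← map_ofNat a 3, ← map_mul, ← map_ofNat C 3, ← map_mul]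
        norm_num
      have hT := eqS_segre_conic e (fun i => a (X i))
        (q := fun j => b (Ideal.Quotient.mk _ (X j))) hq
      have hd : (fun j => (a.comp (algebraMap ℂ (MvPolynomial (Fin 2) ℂ)))
          ((![0, 1, 0, 0] : Fin 4 → ℂ) j)) = ![0, 1, 0, 0] := by
        ext j
        fin_cases j <;> simp
      obtain ⟨f, hf, hfc⟩ := hlift (a.comp (algebraMap ℂ (MvPolynomial (Fin 2) ℂ)))
        (Sum.elim _ _) (by rw [hd]; exact hT)
      refine ⟨f, fun i j => ?_, hfc⟩
      have hfu (i) : f (u i) = _ := hf (Sum.inl i)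
      have hfv (i) : f (v i) = _ := hf (Sum.inr i)
      simp only [Sum.elim_inl, Sum.elim_inr] at hfu hfv
      have h : f (z i j) = 3 * e * (a (X i) * b (Ideal.Quotient.mk _ (X j))) := by
        fin_cases i <;> fin_cases j <;> simp [z, hfu, hfv, map_ofNat f 2] <;> ring
      rw [h, he, one_mul])
  exact nonempty_iso_prodC hp hpq

/-- The homogeneous ideal of the image of `ℙ¹ × ℙ¹` in `ℙ³`. -/
def idealQuadricSurface : HomogeneousIdeal (stdGrading ℂ (Fin 4)) :=
  quadricIdeal (fun _ : Unit => X 0 * X 3 - X 1 * X 2) fun _ =>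
    ((isHomogeneous_X ℂ (0 : Fin 4)).mul (isHomogeneous_X ℂ 3)).sub
      ((isHomogeneous_X ℂ 1).mul (isHomogeneous_X ℂ 2))

theorem quadricSurface_rel {T : Type} [CommRing T]
    (f : MvPolynomial (Fin 4) ℂ ⧸ idealQuadricSurface.toIdeal →+* T) :
    f (Ideal.Quotient.mk _ (X 0)) * f (Ideal.Quotient.mk _ (X 3)) =
      f (Ideal.Quotient.mk _ (X 1)) * f (Ideal.Quotient.mk _ (X 2)) := by
  have hq := eval₂Hom_quadric (F := fun _ : Unit => X 0 * X 3 - X 1 * X 2) _ f ()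
  simp only [map_sub, map_mul, coe_eval₂Hom, eval₂_X, sub_eq_zero] at hq
  exact hq

theorem nonempty_quadricSurface_iso :
    Nonempty (Over.mk (projZerosToSpec idealQuadricSurface) ≅ prodC P1 P1) := by
  let w (i : Fin 4) : MvPolynomial (Fin 4) ℂ ⧸ idealQuadricSurface.toIdeal :=
    Ideal.Quotient.mk _ (X i)
  let z : Fin 2 → Fin 2 → MvPolynomial (Fin 4) ℂ ⧸ idealQuadricSurface.toIdeal :=
    ![![w 0, w 1], ![w 2, w 3]]
  have hw : w 0 * w 3 = w 1 * w 2 := quadricSurface_rel (RingHom.id _)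
  have hw1 := mk_X_mem idealQuadricSurface
  have hz1 (i j) : z i j ∈ quotGrading idealQuadricSurface 1 := by
    fin_cases i <;> fin_cases j
    · exact hw1 0
    · exact hw1 1
    · exact hw1 2
    · exact hw1 3
  have hz : Algebra.adjoin ℂ (Set.range fun ij : Fin 2 × Fin 2 => z ij.1 ij.2) = ⊤ := by
    rw [← top_le_iff, ← adjoin_range_mk_X idealQuadricSurface, Algebra.adjoin_le_iff]
    rintro _ ⟨i, rfl⟩
    apply Algebra.subset_adjoin
    fin_cases i
    · exact ⟨(0, 0), rfl⟩
    · exact ⟨(0, 1), rfl⟩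
    · exact ⟨(1, 0), rfl⟩
    · exact ⟨(1, 1), rfl⟩
  have hminor (j j') : z 0 j * z 1 j' = z 0 j' * z 1 j := by
    fin_cases j <;> fin_cases j' <;> first | rfl | exact hw | exact hw.symm
  obtain ⟨p, q, hp, hpq⟩ := exists_isPullback_segre (𝒜 := stdGrading ℂ (Fin 2))
    (ℬ := stdGrading ℂ (Fin 2)) (𝒮 := quotGrading idealQuadricSurface)
    (x := X) (y := X) adjoin_range_X (isHomogeneous_X ℂ) adjoin_range_X (isHomogeneous_X ℂ) hz1 hz
    (fun j => aeval fun i => z i j) (fun i j => by simp) (fun i => aeval (z i))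
    (fun i j => by simp) (segre_minors hminor) (by
      intro T _ a b hab
      obtain ⟨f, hf, hfc⟩ := exists_quadric_lift (F := fun _ : Unit => X 0 * X 3 - X 1 * X 2)
        (fun _ => ((isHomogeneous_X ℂ (0 : Fin 4)).mul (isHomogeneous_X ℂ 3)).sub
          ((isHomogeneous_X ℂ 1).mul (isHomogeneous_X ℂ 2)))
        (a.comp (algebraMap ℂ (MvPolynomial (Fin 2) ℂ)))
        ![a (X 0) * b (X 0), a (X 0) * b (X 1), a (X 1) * b (X 0), a (X 1) * b (X 1)] (by
          intro i
          simp
          ring)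
      refine ⟨f, fun i j => ?_, hfc⟩
      fin_cases i <;> fin_cases j
      · exact hf 0
      · exact hf 1
      · exact hf 2
      · exact hf 3)
  exact nonempty_iso_prodC hp hpq

/-- The coordinates of `ℙ⁷` on the image of the Segre embedding of `ℙ¹ × ℙ¹ × ℙ¹`. -/
theorem eqS_segre_lines {T : Type} [CommRing T] (e : T) {w : Fin 4 → T} (y : Fin 2 → T)
    (hw : w 0 * w 3 = w 1 * w 2) :
    eqS ![0, 1, 1, 0]
      ![e * (w 1 * y 0 - w 0 * y 1), e * (w 3 * y 0 - w 2 * y 1), e * (w 0 * y 1 - w 2 * y 0),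
        e * (w 1 * y 1 - w 3 * y 0)]
      ![e * (3 * (w 3 * y 1)), e * (w 3 * y 0 + w 2 * y 1 + w 1 * y 1),
        e * (w 0 * y 1 + w 1 * y 0 + w 2 * y 0), e * (3 * (w 0 * y 0))] = 0 := by
  rw [eqS_eq_zero_iff_coord]
  simp only [Matrix.cons_val]
  refine ⟨⟨?_, ?_, ?_⟩, ⟨?_, ?_, ?_⟩, ?_, ?_, ?_⟩
  · linear_combination -3 * e ^ 2 * y 0 ^ 2 * hw
  · linear_combination -3 * e ^ 2 * y 0 * y 1 * hw
  · linear_combination -3 * e ^ 2 * y 1 ^ 2 * hw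
  · linear_combination 3 * e ^ 2 * y 0 ^ 2 * hw
  · linear_combination 3 * e ^ 2 * y 0 * y 1 * hw
  · linear_combination 3 * e ^ 2 * y 1 ^ 2 * hw
  · linear_combination 3 * e ^ 2 * y 1 ^ 2 * hw
  · linear_combination -6 * e ^ 2 * y 0 * y 1 * hw
  · linear_combination 3 * e ^ 2 * y 0 ^ 2 * hw

theorem forall_fin_four_of_symm {P : Fin 4 → Fin 4 → Prop} (hrefl : ∀ i, P i i)
    (hsymm : ∀ i j, P i j → P j i) (h01 : P 0 1) (h02 : P 0 2) (h03 : P 0 3) (h12 : P 1 2)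
    (h13 : P 1 3) (h23 : P 2 3) (i j : Fin 4) : P i j := by
  revert i j
  simp only [Fin.forall_fin_succ, IsEmpty.forall_iff, and_true]
  exact ⟨⟨hrefl 0, h01, h02, h03⟩, ⟨hsymm _ _ h01, hrefl 1, h12, h13⟩,
    ⟨hsymm _ _ h02, hsymm _ _ h12, hrefl 2, h23⟩,
    hsymm _ _ h03, hsymm _ _ h13, hsymm _ _ h23, hrefl 3⟩

/-- The linear forms `w_i y_j` on the image of the Segre embedding of `ℙ¹ × ℙ¹ × ℙ¹`. -/
def segreLines {S : Type} [CommRing S] (u v : Fin 4 → S) : Fin 4 → Fin 2 → S :=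
  ![![v 3, v 2 + u 2 - u 0], ![2 * u 0 + u 2 + v 2, v 1 + u 1 + 2 * u 3],
    ![v 2 - u 0 - 2 * u 2, v 1 - 2 * u 1 - u 3], ![v 1 + u 1 - u 3, v 0]]

theorem segreLines_mem {S : Type} [CommRing S] {M : AddSubgroup S} {u v : Fin 4 → S}
    (hu : ∀ i, u i ∈ M) (hv : ∀ i, v i ∈ M) (i : Fin 4) (j : Fin 2) : segreLines u v i j ∈ M := by
  have h2u (i) : 2 * u i ∈ M := by
    rw [two_mul]
    exact add_mem (hu i) (hu i)
  fin_cases i <;> fin_cases j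
  · exact hv 3
  · exact sub_mem (add_mem (hv 2) (hu 2)) (hu 0)
  · exact add_mem (add_mem (h2u 0) (hu 2)) (hv 2)
  · exact add_mem (add_mem (hv 1) (hu 1)) (h2u 3)
  · exact sub_mem (sub_mem (hv 2) (hu 0)) (h2u 2)
  · exact sub_mem (sub_mem (hv 1) (h2u 1)) (hu 3)
  · exact sub_mem (add_mem (hv 1) (hu 1)) (hu 3)
  · exact hv 0

theorem segreLines_minor {S : Type} [CommRing S] {u v : Fin 4 → S}
    (h : eqS ![0, 1, 1, 0] u v = 0) (j j' : Fin 4) :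
    segreLines u v j 0 * segreLines u v j' 1 = segreLines u v j' 0 * segreLines u v j 1 := by
  rw [eqS_eq_zero_iff_coord] at h
  simp only [Matrix.cons_val] at h
  obtain ⟨⟨h0, h1, h2⟩, ⟨h3, h4, h5⟩, h6, h7, h8⟩ := h
  set z := segreLines u v
  have m01 : z 0 0 * z 1 1 = z 1 0 * z 0 1 := by
    change v 3 * (v 1 + u 1 + 2 * u 3) = (2 * u 0 + u 2 + v 2) * (v 2 + u 2 - u 0)
    linear_combination -h0 - 2 * h3 + h8
  have m02 : z 0 0 * z 2 1 = z 2 0 * z 0 1 := by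
    change v 3 * (v 1 - 2 * u 1 - u 3) = (v 2 - u 0 - 2 * u 2) * (v 2 + u 2 - u 0)
    linear_combination 2 * h0 + h3 + h8
  have m03 : z 0 0 * z 3 1 = z 3 0 * z 0 1 := by
    change v 3 * v 0 = (v 1 + u 1 - u 3) * (v 2 + u 2 - u 0)
    linear_combination h1 - h4 - h7
  have m12 : z 1 0 * z 2 1 = z 2 0 * z 1 1 := by
    change (2 * u 0 + u 2 + v 2) * (v 1 - 2 * u 1 - u 3) =
      (v 2 - u 0 - 2 * u 2) * (v 1 + u 1 + 2 * u 3)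
    linear_combination 3 * h1 + 3 * h4
  have m13 : z 1 0 * z 3 1 = z 3 0 * z 1 1 := by
    change (2 * u 0 + u 2 + v 2) * v 0 = (v 1 + u 1 - u 3) * (v 1 + u 1 + 2 * u 3)
    linear_combination 2 * h2 + h5 + h6
  have m23 : z 2 0 * z 3 1 = z 3 0 * z 2 1 := by
    change (v 2 - u 0 - 2 * u 2) * v 0 = (v 1 + u 1 - u 3) * (v 1 - 2 * u 1 - u 3)
    linear_combination -h2 - 2 * h5 + h6
  exact forall_fin_four_of_symm (P := fun j j' => z j 0 * z j' 1 = z j' 0 * z j 1)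
    (fun _ => rfl) (fun _ _ h => h.symm) m01 m02 m03 m12 m13 m23 j j'

theorem segreLines_quadric {S : Type} [CommRing S] {u v : Fin 4 → S}
    (h : eqS ![0, 1, 1, 0] u v = 0) (i : Fin 2) :
    segreLines u v 0 i * segreLines u v 3 i = segreLines u v 1 i * segreLines u v 2 i := by
  rw [eqS_eq_zero_iff_coord] at h
  simp only [Matrix.cons_val] at h
  obtain ⟨⟨h0, h1, h2⟩, ⟨h3, h4, h5⟩, h6, h7, h8⟩ := h
  fin_cases i
  · change v 3 * (v 1 + u 1 - u 3) = (2 * u 0 + u 2 + v 2) * (v 2 - u 0 - 2 * u 2)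
    linear_combination -h0 + h3 + h8
  · change (v 2 + u 2 - u 0) * v 0 = (v 1 + u 1 + 2 * u 3) * (v 1 - 2 * u 1 - u 3)
    linear_combination -h2 + h5 + h6

theorem mem_adjoin_segreLines {S : Type} [CommRing S] [Algebra ℂ S] (u v : Fin 4 → S) :
    (∀ i, u i ∈ Algebra.adjoin ℂ (Set.range fun ij : Fin 4 × Fin 2 => segreLines u v ij.1 ij.2)) ∧
      ∀ i, v i ∈
        Algebra.adjoin ℂ (Set.range fun ij : Fin 4 × Fin 2 => segreLines u v ij.1 ij.2) := by
  have he := algebraMap_third S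
  set z := segreLines u v
  have hmz (i j) : z i j ∈ Algebra.adjoin ℂ (Set.range fun ij : Fin 4 × Fin 2 => z ij.1 ij.2) :=
    Algebra.subset_adjoin ⟨(i, j), rfl⟩
  have hme := Subalgebra.algebraMap_mem
    (Algebra.adjoin ℂ (Set.range fun ij : Fin 4 × Fin 2 => z ij.1 ij.2)) (1 / 3)
  refine ⟨fun i => ?_, fun i => ?_⟩
  · fin_cases i
    · have h : u 0 = algebraMap ℂ _ (1 / 3) * (z 1 0 - z 0 1) := by
        change u 0 = algebraMap ℂ _ (1 / 3) * (2 * u 0 + u 2 + v 2 - (v 2 + u 2 - u 0))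
        linear_combination -u 0 * he
      exact Eq.mpr (congrArg (· ∈ _) h) (mul_mem hme (sub_mem (hmz 1 0) (hmz 0 1)))
    · have h : u 1 = algebraMap ℂ _ (1 / 3) * (z 3 0 - z 2 1) := by
        change u 1 = algebraMap ℂ _ (1 / 3) * (v 1 + u 1 - u 3 - (v 1 - 2 * u 1 - u 3))
        linear_combination -u 1 * he
      exact Eq.mpr (congrArg (· ∈ _) h) (mul_mem hme (sub_mem (hmz 3 0) (hmz 2 1)))
    · have h : u 2 = algebraMap ℂ _ (1 / 3) * (z 0 1 - z 2 0) := by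
        change u 2 = algebraMap ℂ _ (1 / 3) * (v 2 + u 2 - u 0 - (v 2 - u 0 - 2 * u 2))
        linear_combination -u 2 * he
      exact Eq.mpr (congrArg (· ∈ _) h) (mul_mem hme (sub_mem (hmz 0 1) (hmz 2 0)))
    · have h : u 3 = algebraMap ℂ _ (1 / 3) * (z 1 1 - z 3 0) := by
        change u 3 = algebraMap ℂ _ (1 / 3) * (v 1 + u 1 + 2 * u 3 - (v 1 + u 1 - u 3))
        linear_combination -u 3 * he
      exact Eq.mpr (congrArg (· ∈ _) h) (mul_mem hme (sub_mem (hmz 1 1) (hmz 3 0)))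
  · fin_cases i
    · exact hmz 3 1
    · have h : v 1 = algebraMap ℂ _ (1 / 3) * (z 3 0 + z 2 1 + z 1 1) := by
        change v 1 = algebraMap ℂ _ (1 / 3) *
          (v 1 + u 1 - u 3 + (v 1 - 2 * u 1 - u 3) + (v 1 + u 1 + 2 * u 3))
        linear_combination -v 1 * he
      exact Eq.mpr (congrArg (· ∈ _) h)
        (mul_mem hme (add_mem (add_mem (hmz 3 0) (hmz 2 1)) (hmz 1 1)))
    · have h : v 2 = algebraMap ℂ _ (1 / 3) * (z 0 1 + z 1 0 + z 2 0) := by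
        change v 2 = algebraMap ℂ _ (1 / 3) *
          (v 2 + u 2 - u 0 + (2 * u 0 + u 2 + v 2) + (v 2 - u 0 - 2 * u 2))
        linear_combination -v 2 * he
      exact Eq.mpr (congrArg (· ∈ _) h)
        (mul_mem hme (add_mem (add_mem (hmz 0 1) (hmz 1 0)) (hmz 2 0)))
    · exact hmz 0 0

theorem nonempty_iso_prodC_quadricSurface_P1 {J : HomogeneousIdeal (stdGrading ℂ FIdx)}
    (hJ : RepresentsEqS ![0, 1, 1, 0] J) :
    Nonempty (Over.mk (projZerosToSpec J) ≅
      prodC (Over.mk (projZerosToSpec idealQuadricSurface)) P1) := by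
  have hrel := hJ.rel (RingHom.id _)
  have hmem := mk_X_mem J
  have hgen := @adjoin_eq_top_of_mk_X_mem J
  have hlift := @hJ.lift
  simp only [RingHom.id_apply] at hrel
  set u : Fin 4 → MvPolynomial FIdx ℂ ⧸ J.toIdeal :=
    fun j => Ideal.Quotient.mk J.toIdeal (X (Sum.inl j))
  set v : Fin 4 → MvPolynomial FIdx ℂ ⧸ J.toIdeal :=
    fun j => Ideal.Quotient.mk J.toIdeal (X (Sum.inr j))
  have hd : (fun j => algebraMap ℂ (MvPolynomial FIdx ℂ ⧸ J.toIdeal)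
      ((![0, 1, 1, 0] : Fin 4 → ℂ) j)) = ![0, 1, 1, 0] := by
    ext j
    fin_cases j <;> simp
  rw [hd] at hrel
  let z := segreLines u v
  have hz1 (i j) : z i j ∈ quotGrading J 1 :=
    segreLines_mem (M := (quotGrading J 1).toAddSubgroup) (fun _ => hmem _) (fun _ => hmem _) i j
  have hminor := segreLines_minor hrel
  have hquad (i) : z 0 i * z 3 i = z 1 i * z 2 i := segreLines_quadric hrel i
  have hz : Algebra.adjoin ℂ (Set.range fun ij : Fin 4 × Fin 2 => z ij.1 ij.2) = ⊤ :=
    hgen (mem_adjoin_segreLines u v).1 (mem_adjoin_segreLines u v).2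
  have hα (k : Fin 2) : ∃ f : MvPolynomial (Fin 4) ℂ ⧸ idealQuadricSurface.toIdeal →ₐ[ℂ]
      MvPolynomial FIdx ℂ ⧸ J.toIdeal, ∀ j, f (Ideal.Quotient.mk _ (X j)) = z j k :=
    exists_quadric_liftₐ _ (fun j => z j k) fun _ => by simp [hquad]
  choose α hα using hα
  obtain ⟨p, q, hp, hpq⟩ := exists_isPullback_segre (𝒜 := quotGrading idealQuadricSurface)
    (ℬ := stdGrading ℂ (Fin 2)) (𝒮 := quotGrading J)
    (x := fun i => Ideal.Quotient.mk _ (X i)) (y := X)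
    (adjoin_range_mk_X idealQuadricSurface) (mk_X_mem idealQuadricSurface)
    adjoin_range_X (isHomogeneous_X ℂ) hz1 hz
    α (fun i j => hα j i) (fun i => aeval (z i)) (fun i j => by simp)
    (fun i j i' j' => (segre_minors (z := fun k i => z i k) hminor j i j' i').trans
      (mul_comm _ _)) (by
      intro T _ a b hab
      have hw := quadricSurface_rel a
      obtain ⟨e, he⟩ : ∃ e : T, 3 * e = 1 := by
        refine ⟨b (C (1 / 3)), ?_⟩
        rw [← map_ofNat b 3, ← map_mul, ← map_ofNat C 3, ← map_mul]
        norm_num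
      have hT := eqS_segre_lines e (w := fun j => a (Ideal.Quotient.mk _ (X j)))
        (fun j => b (X j)) hw
      have hd : (fun j => (a.comp (algebraMap ℂ
          (MvPolynomial (Fin 4) ℂ ⧸ idealQuadricSurface.toIdeal)))
          ((![0, 1, 1, 0] : Fin 4 → ℂ) j)) = ![0, 1, 1, 0] := by
        ext j
        fin_cases j <;> simp
      obtain ⟨f, hf, hfc⟩ := hlift (a.comp (algebraMap ℂ
          (MvPolynomial (Fin 4) ℂ ⧸ idealQuadricSurface.toIdeal)))
        (Sum.elim _ _) (by rw [hd]; exact hT)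
      refine ⟨f, fun i j => ?_, hfc⟩
      have hfu (i) : f (u i) = _ := hf (Sum.inl i)
      have hfv (i) : f (v i) = _ := hf (Sum.inr i)
      simp only [Sum.elim_inl, Sum.elim_inr] at hfu hfv
      have h : f (z i j) = 3 * e * (a (Ideal.Quotient.mk _ (X i)) * b (X j)) := by
        fin_cases i <;> fin_cases j <;> simp [z, segreLines, hfu, hfv, map_ofNat f 2] <;> ring
      rw [h, he, one_mul])
  exact nonempty_iso_prodC hp hpq

end ProductFibers

/-! ### The orbits -/

section OrbitClassification

theorem Moves.trans {T : Type} [CommRing T] {g g' : Matrix (Fin 2) (Fin 2) T} {b b' : T}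
    {p q r : Fin 4 → T} (h : Moves g b p q) (h' : Moves g' b' q r) :
    Moves (g' * g) (b' * b) p r where
  det := by rw [Matrix.det_mul, h.det, h'.det, one_mul]
  eq := by
    rw [hat_mul, ← Matrix.mul_assoc, h'.eq, Matrix.smul_mul, Matrix.mul_assoc, h.eq,
      Matrix.mul_smul, smul_smul, Matrix.mul_assoc]

theorem mem_orbitD_iff {p q : Fin 4 → ℂ} :
    q ∈ orbitD p ↔ ∃ g : Matrix (Fin 2) (Fin 2) ℂ, ∃ b : ℂ, b ≠ 0 ∧ Moves g b p q := by
  have hinv {g : Matrix (Fin 2) (Fin 2) ℂ} (hg : g.det = 1) : IsUnit (hat g).det := by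
    rw [← Matrix.isUnit_iff_isUnit_det]
    refine IsUnit.of_mul_eq_one (hat g⁻¹) ?_
    rw [← hat_mul, Matrix.mul_nonsing_inv g (by rw [hg]; exact isUnit_one), hat_one]
  constructor
  · rintro ⟨g, t, h⟩
    refine ⟨g, t.2, t.2.ne_zero, g.det_coe, ?_⟩
    rw [h, Matrix.smul_mul, Matrix.mul_assoc, Matrix.nonsing_inv_mul _ (hinv g.det_coe),
      Matrix.mul_one]
  · rintro ⟨g, b, hb, h⟩
    refine ⟨⟨g, h.det⟩, (1, Units.mk0 b hb), ?_⟩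
    change matV q = b • (g * matV p * (hat g)⁻¹)
    rw [← Matrix.smul_mul, ← h.eq, Matrix.mul_assoc, Matrix.mul_nonsing_inv _ (hinv h.det),
      Matrix.mul_one]

theorem orbitD_symm {p q : Fin 4 → ℂ} (h : q ∈ orbitD p) : p ∈ orbitD q := by
  rw [mem_orbitD_iff] at h ⊢
  obtain ⟨g, b, hb, h⟩ := h
  exact ⟨g⁻¹, b⁻¹, inv_ne_zero hb,
    h.symm (Matrix.nonsing_inv_mul g (by rw [h.det]; exact isUnit_one))
    (inv_mul_cancel₀ hb)⟩

theorem orbitD_trans {p q r : Fin 4 → ℂ} (h : q ∈ orbitD p) (h' : r ∈ orbitD q) :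
    r ∈ orbitD p := by
  rw [mem_orbitD_iff] at h h' ⊢
  obtain ⟨g, b, hb, h⟩ := h
  obtain ⟨g', b', hb', h'⟩ := h'
  exact ⟨g' * g, b' * b, mul_ne_zero hb' hb, h.trans h'⟩

theorem weyl_mem_orbitD (p : Fin 4 → ℂ) : ![-p 3, p 2, -p 1, p 0] ∈ orbitD p :=
  mem_orbitD_iff.2 ⟨!![0, 1; -1, 0], 1, one_ne_zero, by simp, by
    ext i j
    fin_cases i <;> fin_cases j <;>
      simp [matV, hat, Matrix.mul_apply, Fin.sum_univ_succ]⟩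

theorem upper_mem_orbitD (s : ℂ) (p : Fin 4 → ℂ) :
    ![p 0 - 3 * s * p 1 + 3 * s ^ 2 * p 2 - s ^ 3 * p 3, p 1 - 2 * s * p 2 + s ^ 2 * p 3,
      p 2 - s * p 3, p 3] ∈ orbitD p :=
  mem_orbitD_iff.2 ⟨!![1, s; 0, 1], 1, one_ne_zero, by simp, by
    ext i j
    fin_cases i <;> fin_cases j <;>
      simp [matV, hat, Matrix.mul_apply, Fin.sum_univ_succ] <;> ring⟩

theorem lower_mem_orbitD (s : ℂ) (p : Fin 4 → ℂ) :
    ![p 0, p 1 - s * p 0, p 2 - 2 * s * p 1 + s ^ 2 * p 0,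
      p 3 - 3 * s * p 2 + 3 * s ^ 2 * p 1 - s ^ 3 * p 0] ∈ orbitD p :=
  mem_orbitD_iff.2 ⟨!![1, 0; s, 1], 1, one_ne_zero, by simp, by
    ext i j
    fin_cases i <;> fin_cases j <;>
      simp [matV, hat, Matrix.mul_apply, Fin.sum_univ_succ] <;> ring⟩

theorem torus_mem_orbitD {a b : ℂ} (ha : a ≠ 0) (hb : b ≠ 0) (p : Fin 4 → ℂ) :
    ![b * a ^ 3 * p 0, b * a * p 1, b * a⁻¹ * p 2, b * a⁻¹ ^ 3 * p 3] ∈ orbitD p :=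
  mem_orbitD_iff.2 ⟨!![a, 0; 0, a⁻¹], b, hb, by simp [ha], by
    ext i j
    fin_cases i <;> fin_cases j <;>
      simp [matV, hat, Matrix.mul_apply, Fin.sum_univ_succ] <;> field_simp⟩

theorem exists_cubic_root {a : ℂ} (ha : a ≠ 0) (b c d : ℂ) :
    ∃ s : ℂ, a * s ^ 3 + b * s ^ 2 + c * s + d = 0 := by
  have hdeg : (Cubic.toPoly ⟨a, b, c, d⟩).degree ≠ 0 := by
    rw [Cubic.degree_of_a_ne_zero (P := ⟨a, b, c, d⟩) ha]
    norm_num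
  obtain ⟨s, hs⟩ := IsAlgClosed.exists_root _ hdeg
  exact ⟨s, by simpa [Cubic.toPoly, Polynomial.IsRoot] using hs⟩

theorem exists_quadratic_root {a : ℂ} (ha : a ≠ 0) (b c : ℂ) :
    ∃ s : ℂ, a * s ^ 2 + b * s + c = 0 := by
  have hdeg : (Cubic.toPoly ⟨0, a, b, c⟩).degree ≠ 0 := by
    rw [Cubic.degree_of_b_ne_zero (P := ⟨0, a, b, c⟩) rfl ha]
    norm_num
  obtain ⟨s, hs⟩ := IsAlgClosed.exists_root _ hdeg
  exact ⟨s, by simpa [Cubic.toPoly, Polynomial.IsRoot] using hs⟩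

theorem orbitD_zero : orbitD 0 = {0} := by
  have h0 : matV (0 : Fin 4 → ℂ) = 0 := by
    ext i j
    fin_cases i <;> fin_cases j <;> simp [matV]
  ext q
  constructor
  · rintro ⟨g, t, h⟩
    rw [h0, Matrix.mul_zero, Matrix.zero_mul, smul_zero, ← h0] at h
    exact matV_injective h
  · rintro rfl
    exact ⟨1, 1, by simp [h0]⟩

theorem exists_mem_orbitD_zero (p : Fin 4 → ℂ) : ∃ q ∈ orbitD p, q 0 = 0 := by
  by_cases h : p 3 = 0
  · exact ⟨_, weyl_mem_orbitD p, by simp [h]⟩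
  · obtain ⟨s, hs⟩ := exists_cubic_root (neg_ne_zero.2 h) (3 * p 2) (-3 * p 1) (p 0)
    refine ⟨_, upper_mem_orbitD s p, ?_⟩
    simp only [Matrix.cons_val_zero]
    linear_combination hs

/-- The normal forms of the orbits. -/
theorem orbitD_normal_form (p : Fin 4 → ℂ) :
    p = 0 ∨ ![1, 0, 0, 0] ∈ orbitD p ∨ ![0, 1, 0, 0] ∈ orbitD p ∨ ![0, 1, 1, 0] ∈ orbitD p := by
  have scale {c : ℂ} (hc : c ≠ 0) (h : ![0, c, 0, 0] ∈ orbitD p) : ![0, 1, 0, 0] ∈ orbitD p := by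
    refine orbitD_trans h ?_
    simpa [hc] using torus_mem_orbitD one_ne_zero (inv_ne_zero hc) ![0, c, 0, 0]
  obtain ⟨q, hq, hq0⟩ := exists_mem_orbitD_zero p
  by_cases h1 : q 1 = 0
  · by_cases h2 : q 2 = 0
    · by_cases h3 : q 3 = 0
      · left
        have hz : q = 0 := by
          ext i
          fin_cases i <;> assumption
        have h := orbitD_symm hq
        rwa [hz, orbitD_zero] at h
      · right; left
        refine orbitD_trans hq (orbitD_trans (weyl_mem_orbitD q) ?_)
        simpa [h1, h2, hq0, h3] using torus_mem_orbitD one_ne_zero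
          (inv_ne_zero (neg_ne_zero.2 h3)) ![-q 3, q 2, -q 1, q 0]
    · right; right; left
      have hl := lower_mem_orbitD (q 3 / (3 * q 2)) q
      have h3 : q 3 - 3 * (q 3 / (3 * q 2)) * q 2 = 0 := by
        field_simp
        ring
      simp only [hq0, h1, mul_zero, sub_zero, add_zero, h3] at hl
      have hw := weyl_mem_orbitD ![0, 0, q 2, 0]
      simp only [Matrix.cons_val, neg_zero] at hw
      exact scale h2 (orbitD_trans hq (orbitD_trans hl hw))
  · obtain ⟨s, hs⟩ := exists_quadratic_root (mul_ne_zero three_ne_zero h1) (-3 * q 2) (q 3)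
    have hl := lower_mem_orbitD s q
    have h3 : q 3 - 3 * s * q 2 + 3 * s ^ 2 * q 1 = 0 := by linear_combination hs
    simp only [hq0, mul_zero, sub_zero, add_zero, h3] at hl
    have hl' := orbitD_trans hq hl
    by_cases h2 : q 2 - 2 * s * q 1 = 0
    · rw [h2] at hl'
      exact Or.inr (Or.inr (Or.inl (scale h1 hl')))
    · right; right; right
      refine orbitD_trans hl' ?_
      generalize q 2 - 2 * s * q 1 = c at h2
      generalize q 1 = d at h1
      obtain ⟨a, ha⟩ := IsAlgClosed.exists_pow_nat_eq (c / d) two_pos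
      have ha0 : a ≠ 0 := by
        rintro rfl
        exact div_ne_zero h2 h1 (by rw [← ha]; simp)
      have ht := torus_mem_orbitD ha0 (inv_ne_zero (mul_ne_zero ha0 h1)) ![0, d, c, 0]
      have e1 : (a * d)⁻¹ * a * d = 1 := by
        field_simp
      have e2 : (a * d)⁻¹ * a⁻¹ * c = 1 := by
        rw [eq_div_iff h1] at ha
        field_simp
        linear_combination -ha
      simp only [Matrix.cons_val, mul_zero, e1, e2] at ht
      exact ht

theorem wedge2_of_mem_orbitD {p q : Fin 4 → ℂ} (h : q ∈ orbitD p) :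
    ∃ g : Matrix (Fin 2) (Fin 2) ℂ, ∃ b : ℂ, g.det = 1 ∧ b ≠ 0 ∧
      Matrix.vecMul (wedge2 (matV q)) (hatDagger g).transpose = b ^ 2 • wedge2 (matV p) := by
  obtain ⟨g, b, hb, h⟩ := mem_orbitD_iff.1 h
  refine ⟨g, b, h.det, hb, ?_⟩
  have hw := congrArg wedge2 h.eq
  rwa [wedge2_mul_hat, wedge2_smul, wedge2_mul_left, h.det, one_smul, one_smul] at hw

theorem mem_twistedCubicCone_of_mem_orbitD {p q : Fin 4 → ℂ} (h : q ∈ orbitD p)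
    (hq : q ∈ twistedCubicCone) : p ∈ twistedCubicCone := by
  obtain ⟨g, b, -, hb, hw⟩ := wedge2_of_mem_orbitD h
  have hq' : wedge2 (matV q) = 0 := hq
  rw [hq', Matrix.zero_vecMul, eq_comm, smul_eq_zero] at hw
  exact hw.resolve_left (pow_ne_zero 2 hb)

theorem mem_tangentialCone_iff_discr {p : Fin 4 → ℂ} :
    p ∈ tangentialCone ↔
      wedge2 (matV p) 1 ^ 2 - 4 * wedge2 (matV p) 0 * wedge2 (matV p) 2 = 0 := by
  rw [← neg_eq_zero]
  refine iff_of_eq (congrArg (· = 0) ?_)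
  simp [wedge2, matV]
  ring

theorem discr_vecMul_hatDagger (w : Fin 3 → ℂ) (g : Matrix (Fin 2) (Fin 2) ℂ) :
    Matrix.vecMul w (hatDagger g).transpose 1 ^ 2 - 4 *
      Matrix.vecMul w (hatDagger g).transpose 0 * Matrix.vecMul w (hatDagger g).transpose 2 =
      g.det ^ 2 * (w 1 ^ 2 - 4 * w 0 * w 2) := by
  simp [Matrix.vecMul, dotProduct, hatDagger, Fin.sum_univ_succ, Matrix.det_fin_two]
  ring

theorem mem_tangentialCone_of_mem_orbitD {p q : Fin 4 → ℂ} (h : q ∈ orbitD p)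
    (hq : q ∈ tangentialCone) : p ∈ tangentialCone := by
  obtain ⟨g, b, hg, hb, hw⟩ := wedge2_of_mem_orbitD h
  rw [mem_tangentialCone_iff_discr] at hq ⊢
  have hd := discr_vecMul_hatDagger (wedge2 (matV q)) g
  rw [hw, hq, hg] at hd
  simp only [Pi.smul_apply, smul_eq_mul] at hd
  refine (mul_eq_zero.1 (?_ : b ^ 4 * _ = 0)).resolve_left (pow_ne_zero 4 hb)
  linear_combination hd

theorem twistedCubicCone_subset_tangentialCone : twistedCubicCone ⊆ tangentialCone := by
  intro p hp
  have hp' : wedge2 (matV p) = 0 := hp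
  rw [mem_tangentialCone_iff_discr, hp']
  simp

theorem not_mem_twistedCubicCone : (![0, 1, 0, 0] : Fin 4 → ℂ) ∉ twistedCubicCone := by
  intro h
  have h' := congrFun (h : wedge2 (matV _) = 0) 0
  simp [wedge2, matV] at h'

theorem not_mem_tangentialCone : (![0, 1, 1, 0] : Fin 4 → ℂ) ∉ tangentialCone := by
  simp [tangentialCone]

theorem mem_twistedCubicCone : (![1, 0, 0, 0] : Fin 4 → ℂ) ∈ twistedCubicCone := by
  ext i
  fin_cases i <;> simp [wedge2, matV]

theorem mem_tangentialCone : (![0, 1, 0, 0] : Fin 4 → ℂ) ∈ tangentialCone := by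
  simp [tangentialCone]

theorem mem_twistedCubicCone_diff_iff {p : Fin 4 → ℂ} :
    p ∈ twistedCubicCone \ {0} ↔ p ∈ orbitD ![1, 0, 0, 0] := by
  constructor
  · rintro ⟨hp, hp0⟩
    rcases orbitD_normal_form p with h | h | h | h
    · exact absurd h hp0
    · exact orbitD_symm h
    · exact absurd (mem_twistedCubicCone_of_mem_orbitD (orbitD_symm h) hp) not_mem_twistedCubicCone
    · exact absurd (mem_tangentialCone_of_mem_orbitD (orbitD_symm h)
        (twistedCubicCone_subset_tangentialCone hp)) not_mem_tangentialCone
  · intro h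
    refine ⟨mem_twistedCubicCone_of_mem_orbitD (orbitD_symm h) mem_twistedCubicCone, ?_⟩
    rintro rfl
    have h' := orbitD_symm h
    rw [orbitD_zero] at h'
    simpa using congrFun h' 0

theorem mem_tangentialCone_diff_iff {p : Fin 4 → ℂ} :
    p ∈ tangentialCone \ twistedCubicCone ↔ p ∈ orbitD ![0, 1, 0, 0] := by
  constructor
  · rintro ⟨hp, hpC⟩
    rcases orbitD_normal_form p with rfl | h | h | h
    · refine absurd (?_ : wedge2 (matV 0) = 0) hpC
      ext i
      fin_cases i <;> simp [wedge2, matV]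
    · exact absurd (mem_twistedCubicCone_of_mem_orbitD h mem_twistedCubicCone) hpC
    · exact orbitD_symm h
    · exact absurd (mem_tangentialCone_of_mem_orbitD (orbitD_symm h) hp) not_mem_tangentialCone
  · intro h
    exact ⟨mem_tangentialCone_of_mem_orbitD (orbitD_symm h) mem_tangentialCone,
      fun hp => not_mem_twistedCubicCone (mem_twistedCubicCone_of_mem_orbitD h hp)⟩

theorem mem_tangentialCone_compl_iff {p : Fin 4 → ℂ} :
    p ∈ tangentialConeᶜ ↔ p ∈ orbitD ![0, 1, 1, 0] := by
  constructor
  · intro hp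
    rcases orbitD_normal_form p with rfl | h | h | h
    · exact absurd (by simp [tangentialCone]) hp
    · exact absurd (mem_tangentialCone_of_mem_orbitD h
        (twistedCubicCone_subset_tangentialCone mem_twistedCubicCone)) hp
    · exact absurd (mem_tangentialCone_of_mem_orbitD h mem_tangentialCone) hp
    · exact orbitD_symm h
  · exact fun h hp => not_mem_tangentialCone (mem_tangentialCone_of_mem_orbitD h hp)

theorem orbitD_eq_of_mem_iff {S : Set (Fin 4 → ℂ)} {p₀ : Fin 4 → ℂ}
    (hS : ∀ {p}, p ∈ S ↔ p ∈ orbitD p₀) {p : Fin 4 → ℂ} (hp : p ∈ S) : orbitD p = S := by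
  ext q
  rw [hS]
  exact ⟨fun h => orbitD_trans (hS.1 hp) h, fun h => orbitD_trans (orbitD_symm (hS.1 hp)) h⟩

theorem nonempty_fiber_iso_of_mem_orbitD {J : HomogeneousIdeal (stdGrading ℂ FIdx)}
    {p q : Fin 4 → ℂ} (hJ : RepresentsEqS p J) (h : q ∈ orbitD p) :
    Nonempty (fiber q ≅ Over.mk (projZerosToSpec J)) := by
  obtain ⟨g, b, hb, h⟩ := mem_orbitD_iff.1 h
  exact nonempty_fiber_iso hJ h hb

end OrbitClassification

end SFib
end

theorem mainTheorem10 (p : Fin 4 → ℂ) :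
    (p = 0 →
      SFib.orbitD p = {0} ∧
        Nonempty (SFib.fiberInProj p ≅ SFib.zeroFiberInProj)) ∧
    (p ∈ SFib.twistedCubicCone \ {0} →
      SFib.orbitD p = SFib.twistedCubicCone \ {0} ∧
        Nonempty (SFib.fiber p ≅ SFib.P111)) ∧
    (p ∈ SFib.tangentialCone \ SFib.twistedCubicCone →
      SFib.orbitD p = SFib.tangentialCone \ SFib.twistedCubicCone ∧
        Nonempty (SFib.fiber p ≅ SFib.prodC SFib.P1 SFib.Q)) ∧
    (p ∈ SFib.tangentialConeᶜ →
      SFib.orbitD p = SFib.tangentialConeᶜ ∧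
        Nonempty (SFib.fiber p ≅ SFib.prodC (SFib.prodC SFib.P1 SFib.P1) SFib.P1)) := by
  refine ⟨?_, fun h => ⟨SFib.orbitD_eq_of_mem_iff SFib.mem_twistedCubicCone_diff_iff h, ?_⟩,
    fun h => ⟨SFib.orbitD_eq_of_mem_iff SFib.mem_tangentialCone_diff_iff h, ?_⟩,
    fun h => ⟨SFib.orbitD_eq_of_mem_iff SFib.mem_tangentialCone_compl_iff h, ?_⟩⟩
  · rintro rfl
    exact ⟨SFib.orbitD_zero, SFib.nonempty_fiberInProj_zero_iso⟩
  · exact SFib.nonempty_fiber_iso_of_mem_orbitD SFib.representsEqS_idealP111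
      (SFib.mem_twistedCubicCone_diff_iff.1 h)
  · obtain ⟨e⟩ := SFib.nonempty_fiber_iso_of_mem_orbitD (SFib.representsEqS_fiberIdeal _)
      (SFib.mem_tangentialCone_diff_iff.1 h)
    obtain ⟨f⟩ := SFib.nonempty_iso_prodC_P1_Q (SFib.representsEqS_fiberIdeal _)
    exact ⟨e ≪≫ f⟩
  · obtain ⟨e⟩ := SFib.nonempty_fiber_iso_of_mem_orbitD (SFib.representsEqS_fiberIdeal _)
      (SFib.mem_tangentialCone_compl_iff.1 h)
    obtain ⟨f⟩ := SFib.nonempty_iso_prodC_quadricSurface_P1 (SFib.representsEqS_fiberIdeal _)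
    obtain ⟨f'⟩ := SFib.nonempty_quadricSurface_iso
    obtain ⟨f''⟩ := SFib.nonempty_prodC_iso_left f' SFib.P1
    exact ⟨e ≪≫ f ≪≫ f''⟩
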